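/- Let $\mathcal M$ be a von Neumann algebra on a complex Hilbert space $H$, and let $a$ be an injective positive selfadjoint (possibly unbounded) operator affiliated with $\mathcal M$. For $\lambda>0$ put $a_\lambda=\lambda a(\lambda+a)^{-1}\in\mathcal M^+$, and for a positive normal (i.e. ultraweakly continuous) functional $\varphi\in\mathcal M_*^+$ put $\varphi(a)=\lim_{\lambda\to+\infty}\varphi(a_\lambda)\in[0,+\infty]$. Let $\mathfrak D_a^+=\{\varphi\in\mathcal M_*^+:\varphi(a)<+\infty\}$, let $\mathfrak D_a^h=\mathfrak D_a^+-\mathfrak D_a^+$, and for $\varphi\in\mathfrak D_a^h$ let $$\|\varphi\|_a=\inf\{\varphi_1(a)+\varphi_2(a)\;:\;\varphi=\varphi_1-\varphi_2,\ \varphi_1,\varphi_2\in\mathfrak D_a^+\}.$$ Let $L_1^h(a)$ be the completion of $(\mathfrak D_a^h,\|\cdot\|_a)$ and let $L_1(a)=L_1^h(a)+iL_1^h(a)$ be its complexification. For $\varphi\in\mathfrak D_a^h$ and $x\in\mathcal M$ put $a^{1/2}\varphi a^{1/2}(x)=\lim_{\lambda\to+\infty}\varphi(a_\lambda^{1/2}xa_\lambda^{1/2})$;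 extend this by $\|\cdot\|_a$-continuity to $\varphi\in L_1^h(a)$ and complex linearly to $\varphi\in L_1(a)$, and let $\|\varphi\|_a=\sup_{x\in\mathcal M,\ \|x\|\le1}|a^{1/2}\varphi a^{1/2}(x)|$ for $\varphi\in L_1(a)$. Let $L_1^+(a)$ be the set of all $\varphi\in L_1(a)$ such that $a^{1/2}\varphi a^{1/2}(x)\ge0$ for every $x\in\mathcal M$ for which the sesquilinear form $(f,g)\mapsto\langle xa^{1/2}f,a^{1/2}g\rangle$ on $D(a^{1/2})$ is positive, i.e. satisfies $\langle xa^{1/2}f,a^{1/2}f\rangle\ge0$ for all $f\in D(a^{1/2})$. Then the canonical map $\mathfrak D_a^h\to L_1(a)$ is injective and, identifying $\mathfrak D_a^h$ with its image, $\mathfrak D_a^+$ is a dense subset of $L_1^+(a)$ for the $a$-norm: $\mathfrak D_a^+\subset L_1^+(a)$, and for every $\varphi\in L_1^+(a)$ and $\varepsilon>0$ there is $\psi\in\mathfrak D_a^+$ with $\|\varphi-\psi\|_a<\varepsilon$. Moreover $L_1^+(a)\subset L_1^h(a)$, and $\mathfrak D_a^+$ is also dense in $L_1^+(a)$ for the norm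 of the completion $L_1^h(a)$. -/

import Mathlib

open Filter Topology
open scoped ENNReal ComplexOrder

noncomputable section

namespace AffiliatedL1

variable {H : Type*} [NormedAddCommGroup H] [InnerProductSpace ℂ H] [CompleteSpace H]

/-- A positive selfadjoint (in general unbounded) operator on `H` affiliated with the von Neumann
algebra `M`, i.e. `b a ⊆ a b` for every `b` in the commutant of `M`. -/
structure PosAffiliatedOp (M : VonNeumannAlgebra H) where
  /-- the operator with its domain -/
  op : H →ₗ.[ℂ] H
  selfAdjoint : IsSelfAdjoint op
  nonneg : ∀ f : op.domain, 0 ≤ inner ℂ (f : H) (op f)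
  affiliated : ∀ b ∈ M.commutant, ∀ f : op.domain,
    ∃ h : b (f : H) ∈ op.domain, op ⟨b (f : H), h⟩ = b (op f)

/-! ### Normal functionals -/

/-- Linear functionals on the von Neumann algebra `M`. -/
abbrev Functional (M : VonNeumannAlgebra H) := M.toStarSubalgebra →ₗ[ℂ] ℂ

/-- The ultraweak (`σ`-weak) topology on `M`: the coarsest topology that makes all the functionals
`x ↦ ∑ₙ ⟨x ξₙ, ηₙ⟩` with `∑ₙ ‖ξₙ‖² < ∞` and `∑ₙ ‖ηₙ‖² < ∞` continuous. -/
abbrev ultraweakTopology (M : VonNeumannAlgebra H) : TopologicalSpace M.toStarSubalgebra :=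
  ⨅ (ξ : lp (fun _ : ℕ => H) 2) (η : lp (fun _ : ℕ => H) 2),
    TopologicalSpace.induced
      (fun x : M.toStarSubalgebra => ∑' n, inner ℂ (η n) ((x : H →L[ℂ] H) (ξ n))) inferInstance

/-- Normal functionals, i.e. elements of the predual `M_*`: the ultraweakly continuous ones. -/
def IsNormal {M : VonNeumannAlgebra H} (φ : Functional M) : Prop :=
  Continuous[ultraweakTopology M, inferInstance] φ

/-- Positive functionals. -/
def IsPos {M : VonNeumannAlgebra H} (φ : Functional M) : Prop :=
  ∀ x : M.toStarSubalgebra, (x : H →L[ℂ] H).IsPositive → 0 ≤ φ x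

theorem mem_of_commute {M : VonNeumannAlgebra H} {z : H →L[ℂ] H}
    (h : ∀ b ∈ M.commutant, b * z = z * b) : z ∈ M := by
  have h' : z ∈ M.commutant.commutant := VonNeumannAlgebra.mem_commutant_iff.2 h
  rwa [M.commutant_commutant] at h'

/-! ### Bounded approximations of an affiliated operator -/

namespace PosAffiliatedOp

variable {M : VonNeumannAlgebra H} (a : PosAffiliatedOp M)

theorem lower_bound (l : ℝ) (f : a.op.domain) :
    l * ‖(f : H)‖ ≤ ‖a.op f + (l : ℂ) • (f : H)‖ := by
  have h0 := (Complex.le_def.1 (a.nonneg f)).1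
  simp only [Complex.zero_re] at h0
  have h1 : l * ‖(f : H)‖ ^ 2 ≤ (inner ℂ (f : H) (a.op f + (l : ℂ) • (f : H))).re := by
    rw [inner_add_right, inner_smul_right, inner_self_eq_norm_sq_to_K]
    have : ((l : ℂ) * ((‖(f : H)‖ : ℂ)) ^ 2).re = l * ‖(f : H)‖ ^ 2 := by
      rw [← Complex.ofReal_pow, ← Complex.ofReal_mul, Complex.ofReal_re]
    simp only [Complex.add_re]
    erw [this]
    linarith
  have h2 : (inner ℂ (f : H) (a.op f + (l : ℂ) • (f : H))).re
      ≤ ‖(f : H)‖ * ‖a.op f + (l : ℂ) • (f : H)‖ :=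
    (Complex.re_le_norm _).trans (norm_inner_le_norm _ _)
  rcases (norm_nonneg (f : H)).eq_or_lt with h | h
  · rw [← h]; simp
  · have : ‖(f : H)‖ * (l * ‖(f : H)‖) ≤ ‖(f : H)‖ * ‖a.op f + (l : ℂ) • (f : H)‖ := by nlinarith
    exact le_of_mul_le_mul_left this h

theorem eq_of_shift_eq {l : ℝ} (hl : 0 < l) {f g : a.op.domain}
    (h : a.op f + (l : ℂ) • (f : H) = a.op g + (l : ℂ) • (g : H)) : f = g := by
  have h1 := a.lower_bound l (f - g)
  have h2 : a.op (f - g) + (l : ℂ) • ((f - g : a.op.domain) : H) = 0 := by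
    rw [LinearPMap.map_sub, Submodule.coe_sub, smul_sub]
    rw [← sub_eq_zero] at h
    rw [← h]; abel
  rw [h2, norm_zero] at h1
  have h3 : ‖((f - g : a.op.domain) : H)‖ ≤ 0 := by
    by_contra hc
    push Not at hc
    nlinarith
  have h4 : ((f - g : a.op.domain) : H) = 0 := norm_le_zero_iff.1 h3
  exact sub_eq_zero.1 (Subtype.ext h4)

/-- The linear map `f ↦ a f + l f` on the domain of `a`. -/
def shift (l : ℝ) : a.op.domain →ₗ[ℂ] H := a.op.toFun + (l : ℂ) • a.op.domain.subtype

theorem shift_apply (l : ℝ) (f : a.op.domain) : a.shift l f = a.op f + (l : ℂ) • (f : H) := rfl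

theorem isClosed_range_shift {l : ℝ} (hl : 0 < l) :
    IsClosed ((LinearMap.range (a.shift l) : Submodule ℂ H) : Set H) := by
  refine isClosed_of_closure_subset fun y hy => ?_
  obtain ⟨u, hu, hlim⟩ := mem_closure_iff_seq_limit.1 hy
  choose f hf using hu
  have hc : CauchySeq fun n => (f n : H) := by
    rw [Metric.cauchySeq_iff]
    intro ε hε
    obtain ⟨N, hN⟩ := Metric.cauchySeq_iff.1 hlim.cauchySeq (l * ε) (by positivity)
    refine ⟨N, fun m hm n hn => ?_⟩
    have h1 := hN m hm n hn
    have h2 := a.lower_bound l (f m - f n)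
    rw [← shift_apply, map_sub, hf, hf, ← dist_eq_norm] at h2
    rw [Submodule.coe_sub, ← dist_eq_norm] at h2
    exact lt_of_mul_lt_mul_left (h2.trans_lt h1) hl.le
  obtain ⟨g, hg⟩ := cauchySeq_tendsto_of_complete hc
  have h3 : Tendsto (fun n => a.op (f n)) atTop (𝓝 (y - (l : ℂ) • g)) := by
    have : (fun n => a.op (f n)) = fun n => u n - (l : ℂ) • (f n : H) := by
      funext n
      rw [← hf n, shift_apply]; abel
    rw [this]
    exact hlim.sub (hg.const_smul _)
  have hcl : _root_.IsClosed (a.op.graph : Set (H × H)) := a.selfAdjoint.isClosed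
  have h4 : (g, y - (l : ℂ) • g) ∈ (a.op.graph : Set (H × H)) :=
    hcl.mem_of_tendsto (hg.prodMk_nhds h3) (Eventually.of_forall fun n => a.op.mem_graph (f n))
  obtain ⟨k, hk1, hk2⟩ := (LinearPMap.mem_graph_iff _).1 h4
  refine ⟨k, ?_⟩
  simp only at hk1 hk2
  rw [shift_apply, hk1, hk2]; abel

theorem shift_surjective {l : ℝ} (hl : 0 < l) : Function.Surjective (a.shift l) := by
  rw [← LinearMap.range_eq_top]
  have : CompleteSpace (LinearMap.range (a.shift l) : Submodule ℂ H) :=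
    (a.isClosed_range_shift hl).completeSpace_coe
  rw [← Submodule.orthogonal_eq_bot_iff, Submodule.eq_bot_iff]
  intro y hy
  have hy' : ∀ f : a.op.domain, inner ℂ (-(l : ℂ) • y) (f : H) = inner ℂ y (a.op f) := by
    intro f
    have h := (Submodule.mem_orthogonal' _ _).1 hy (a.shift l f) ⟨f, rfl⟩
    rw [shift_apply, inner_add_right, inner_smul_right] at h
    rw [inner_smul_left]
    simp only [map_neg, Complex.conj_ofReal]
    linear_combination -h
  have hd : y ∈ a.op.adjoint.domain := a.op.mem_adjoint_domain_of_exists y ⟨_, hy'⟩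
  have hv : a.op.adjoint ⟨y, hd⟩ = -(l : ℂ) • y :=
    LinearPMap.adjoint_apply_eq a.selfAdjoint.dense_domain ⟨y, hd⟩ hy'
  have hgr : (y, -(l : ℂ) • y) ∈ a.op.adjoint.graph := by
    rw [← hv]; exact a.op.adjoint.mem_graph ⟨y, hd⟩
  rw [LinearPMap.isSelfAdjoint_def.1 a.selfAdjoint] at hgr
  obtain ⟨k, hk1, hk2⟩ := (LinearPMap.mem_graph_iff _).1 hgr
  simp only at hk1 hk2
  have h0 := a.lower_bound l k
  rw [hk2, hk1] at h0
  have h1 : -(l : ℂ) • y + (l : ℂ) • y = 0 := by rw [← add_smul]; simp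
  rw [h1, norm_zero] at h0
  have h2 : ‖y‖ ≤ 0 := by
    by_contra hc
    push Not at hc
    nlinarith
  exact norm_le_zero_iff.1 h2

theorem exists_resolvent {l : ℝ} (hl : 0 < l) :
    ∃ R : H →L[ℂ] H, ∀ f : H, ∃ h : R f ∈ a.op.domain,
      a.op ⟨R f, h⟩ + (l : ℂ) • R f = f := by
  have hinj : Function.Injective (a.shift l) := fun f g h => a.eq_of_shift_eq hl h
  let e := LinearEquiv.ofBijective (a.shift l) ⟨hinj, a.shift_surjective hl⟩
  have he : ∀ f, a.op (e.symm f) + (l : ℂ) • (e.symm f : H) = f := fun f =>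
    e.apply_symm_apply f
  let R : H →L[ℂ] H := (a.op.domain.subtype ∘ₗ e.symm.toLinearMap).mkContinuous l⁻¹ (by
    intro f
    have h := a.lower_bound l (e.symm f)
    rw [he] at h
    change ‖((e.symm f : a.op.domain) : H)‖ ≤ _
    rw [inv_mul_eq_div, le_div_iff₀ hl]
    linarith)
  exact ⟨R, fun f => ⟨(e.symm f).2, he f⟩⟩

/-- The resolvent `(l + a)⁻¹` for `l > 0`. -/
def resolvent (l : ℝ) (hl : 0 < l) : H →L[ℂ] H := (a.exists_resolvent hl).choose

theorem resolvent_spec (l : ℝ) (hl : 0 < l) (f : H) :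
    ∃ h : a.resolvent l hl f ∈ a.op.domain,
      a.op ⟨a.resolvent l hl f, h⟩ + (l : ℂ) • a.resolvent l hl f = f :=
  (a.exists_resolvent hl).choose_spec f

theorem resolvent_mem (l : ℝ) (hl : 0 < l) : a.resolvent l hl ∈ M := by
  refine mem_of_commute fun b hb => ?_
  ext f
  obtain ⟨h1, e1⟩ := a.resolvent_spec l hl f
  obtain ⟨h2, e2⟩ := a.resolvent_spec l hl (b f)
  obtain ⟨h3, e3⟩ := a.affiliated b hb ⟨_, h1⟩
  have : (⟨_, h3⟩ : a.op.domain) = ⟨_, h2⟩ := by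
    refine a.eq_of_shift_eq hl ?_
    rw [e2, e3]
    change b (a.op ⟨_, h1⟩) + (l : ℂ) • b (a.resolvent l hl f) = b f
    rw [← map_smul, ← map_add, e1]
  exact congrArg Subtype.val this

/-- The bounded operator `a_l = l a (l + a)⁻¹ = l (1 - l (l + a)⁻¹)` in `M`, for `l > 0`
(and `0` for `l ≤ 0`). -/
def approx (l : ℝ) : M.toStarSubalgebra :=
  if hl : 0 < l then (l : ℂ) • (1 - (l : ℂ) • ⟨a.resolvent l hl, a.resolvent_mem l hl⟩) else 0

/-- `a_l = l a (l + a)⁻¹`. -/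
theorem approx_apply (l : ℝ) (hl : 0 < l) (f : H) :
    (a.approx l : H →L[ℂ] H) f
      = (l : ℂ) • a.op ⟨a.resolvent l hl f, (a.resolvent_spec l hl f).1⟩ := by
  have h := (a.resolvent_spec l hl f).2
  rw [approx, dif_pos hl]
  change (l : ℂ) • (f - (l : ℂ) • a.resolvent l hl f) = _
  nth_rw 1 [← h]
  rw [add_sub_cancel_right]

theorem sqrt_approx_mem (l : ℝ) : CFC.sqrt (a.approx l : H →L[ℂ] H) ∈ M := by
  refine mem_of_commute fun b hb => ?_
  have hc : Commute (a.approx l : H →L[ℂ] H) b :=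
    VonNeumannAlgebra.mem_commutant_iff.1 hb _ (a.approx l).2
  exact (hc.cfcₙ_nnreal NNReal.sqrt).symm.eq

/-- The bounded positive operator `a_l^{1/2}` in `M`. -/
def sqrtApprox (l : ℝ) : M.toStarSubalgebra :=
  ⟨CFC.sqrt (a.approx l : H →L[ℂ] H), a.sqrt_approx_mem l⟩

/-- The operator `a^{1/2}`: the strong limit of `a_l^{1/2}` as `l → ∞`, defined on the vectors on
which the limit exists. -/
def sqrtOp : H →ₗ.[ℂ] H where
  domain :=
    { carrier := {f | ∃ g, Tendsto (fun l => (a.sqrtApprox l : H →L[ℂ] H) f) atTop (𝓝 g)}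
      add_mem' := by
        rintro f₁ f₂ ⟨g₁, h₁⟩ ⟨g₂, h₂⟩
        exact ⟨g₁ + g₂, by simpa only [map_add] using h₁.add h₂⟩
      zero_mem' := ⟨0, by simp⟩
      smul_mem' := by
        rintro c f ⟨g, h⟩
        exact ⟨c • g, by simpa only [map_smul] using h.const_smul c⟩ }
  toFun :=
    { toFun := fun f => limUnder atTop fun l => (a.sqrtApprox l : H →L[ℂ] H) f
      map_add' := by
        rintro ⟨f₁, g₁, h₁⟩ ⟨f₂, g₂, h₂⟩
        simp only [Submodule.coe_add, map_add]
        rw [h₁.limUnder_eq, h₂.limUnder_eq, (h₁.add h₂).limUnder_eq]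
      map_smul' := by
        rintro c ⟨f, g, h⟩
        simp only [Submodule.coe_smul, map_smul, RingHom.id_apply]
        rw [h.limUnder_eq, (h.const_smul c).limUnder_eq] }

/-! ### The space `𝔇_a^h` with the `a`-norm -/

/-- The value `φ(a) = lim_{l → ∞} φ(a_l) = sup_{l > 0} φ(a_l)` in `[0, ∞]` of a positive functional
at `a`; note that `φ(a_l) ≥ 0` is increasing in `l`. -/
def eval (φ : Functional M) : ℝ≥0∞ :=
  ⨆ (l : ℝ) (_ : 0 < l), ENNReal.ofReal (φ (a.approx l)).re

theorem approx_sub_isPositive {l m : ℝ} (hl : 0 < l) (hlm : l ≤ m) :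
    ((a.approx m - a.approx l : M.toStarSubalgebra) : H →L[ℂ] H).IsPositive := by
  have hm : 0 < m := hl.trans_le hlm
  have hsymm : ∀ x y : a.op.domain, inner ℂ (a.op x) (y : H) = inner ℂ (x : H) (a.op y) := by
    have h := LinearPMap.adjoint_isFormalAdjoint a.selfAdjoint.dense_domain
    rw [LinearPMap.isSelfAdjoint_def.1 a.selfAdjoint] at h
    exact h
  rw [ContinuousLinearMap.isPositive_iff_complex]
  intro f
  obtain ⟨v, hv⟩ := a.shift_surjective hm f
  obtain ⟨w, hw⟩ := a.shift_surjective hl v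
  rw [shift_apply] at hv hw
  have hawm : a.op w ∈ a.op.domain := by
    rw [← eq_sub_iff_add_eq] at hw
    rw [hw]
    exact sub_mem v.2 (a.op.domain.smul_mem _ w.2)
  set y : a.op.domain := ⟨a.op w, hawm⟩ with hy
  have hvy : v = y + (l : ℂ) • w := Subtype.ext hw.symm
  have hav : a.op v = a.op y + (l : ℂ) • a.op w := by
    rw [hvy, LinearPMap.map_add, LinearPMap.map_smul]
  have hf : f = a.op y + (l + m : ℂ) • (y : H) + (l * m : ℂ) • (w : H) := by
    rw [← hv, hav, hvy, Submodule.coe_add, Submodule.coe_smul]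
    change a.op y + (l : ℂ) • (y : H) + _ = _
    module
  have hRm : (⟨a.resolvent m hm f, (a.resolvent_spec m hm f).1⟩ : a.op.domain) = v :=
    a.eq_of_shift_eq hm ((a.resolvent_spec m hm f).2.trans hv.symm)
  have hRl : (⟨a.resolvent l hl f, (a.resolvent_spec l hl f).1⟩ : a.op.domain)
      = y + (m : ℂ) • w := by
    refine a.eq_of_shift_eq hl ((a.resolvent_spec l hl f).2.trans ?_)
    rw [LinearPMap.map_add, LinearPMap.map_smul, Submodule.coe_add, Submodule.coe_smul, hf]
    change _ = a.op y + (m : ℂ) • (y : H) + _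
    module
  have hdiff : ((a.approx m - a.approx l : M.toStarSubalgebra) : H →L[ℂ] H) f
      = ((m - l : ℝ) : ℂ) • a.op y := by
    change (a.approx m : H →L[ℂ] H) f - (a.approx l : H →L[ℂ] H) f = _
    rw [a.approx_apply m hm, a.approx_apply l hl, hRm, hRl, hav, LinearPMap.map_add,
      LinearPMap.map_smul]
    push_cast
    module
  have hpos : 0 ≤ inner ℂ (a.op y) f := by
    rw [hf, inner_add_right, inner_add_right, inner_smul_right, inner_smul_right]
    have e1 : inner ℂ (a.op y) (w : H) = inner ℂ (y : H) (y : H) := hsymm y w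
    have e2 : inner ℂ (a.op y) (y : H) = inner ℂ (y : H) (a.op y) := hsymm y y
    rw [e1, e2]
    have p : ∀ x : H, (0 : ℂ) ≤ inner ℂ x x := fun x => by
      rw [inner_self_eq_norm_sq_to_K]
      have h : (0 : ℂ) ≤ ((‖x‖ ^ 2 : ℝ) : ℂ) := Complex.zero_le_real.2 (sq_nonneg ‖x‖)
      rwa [Complex.ofReal_pow] at h
    have p1 : (0 : ℂ) ≤ inner ℂ (a.op y) (a.op y) := p _
    have p2 : (0 : ℂ) ≤ inner ℂ (y : H) (y : H) := p _
    have q1 : (0 : ℂ) ≤ l := by exact_mod_cast hl.le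
    have q2 : (0 : ℂ) ≤ m := by exact_mod_cast hm.le
    exact add_nonneg (add_nonneg p1 (mul_nonneg (add_nonneg q1 q2) (a.nonneg y)))
      (mul_nonneg (mul_nonneg q1 q2) p2)
  have hpos' : 0 ≤ inner ℂ (((a.approx m - a.approx l : M.toStarSubalgebra) : H →L[ℂ] H) f) f := by
    rw [hdiff, inner_smul_left, Complex.conj_ofReal]
    exact mul_nonneg (by exact_mod_cast sub_nonneg.2 hlm) hpos
  obtain ⟨h1, h2⟩ := Complex.le_def.1 hpos'
  exact ⟨Complex.ext rfl h2, h1⟩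

/-- For positive `φ`, the value `φ(a)` is the limit of `φ(a_l)` as `l → ∞`. -/
theorem tendsto_eval {φ : Functional M} (hφ : IsPos φ) :
    Tendsto (fun l : ℝ => ENNReal.ofReal (φ (a.approx l)).re) atTop (𝓝 (a.eval φ)) := by
  have hmono : Monotone fun l : ℝ => ENNReal.ofReal (φ (a.approx l)).re := by
    intro l m hlm
    rcases le_or_gt l 0 with h0 | h0
    · have : a.approx l = 0 := dif_neg h0.not_gt
      simp [this]
    · refine ENNReal.ofReal_le_ofReal ?_
      have h := (Complex.le_def.1 (hφ _ (a.approx_sub_isPositive h0 hlm))).1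
      rw [map_sub, Complex.sub_re, Complex.zero_re] at h
      linarith
  have heq : a.eval φ = ⨆ l : ℝ, ENNReal.ofReal (φ (a.approx l)).re := by
    refine le_antisymm (iSup_mono fun l => iSup_le fun _ => le_rfl) (iSup_le fun l => ?_)
    rcases le_or_gt l 0 with h0 | h0
    · have : a.approx l = 0 := dif_neg h0.not_gt
      simp [this]
    · exact le_iSup₂ (f := fun (l : ℝ) (_ : 0 < l) => ENNReal.ofReal (φ (a.approx l)).re) l h0
  rw [heq]
  exact tendsto_atTop_iSup hmono

/-- `𝔇_a^+`: the positive normal functionals with `φ(a) < ∞`. -/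
def Dpos : Set (Functional M) := {φ | IsPos φ ∧ IsNormal φ ∧ a.eval φ < ∞}

theorem eval_add_le (φ ψ : Functional M) : a.eval (φ + ψ) ≤ a.eval φ + a.eval ψ := by
  refine iSup₂_le fun l hl => ?_
  rw [LinearMap.add_apply, Complex.add_re]
  exact ENNReal.ofReal_add_le.trans (add_le_add
    (le_iSup₂ (f := fun (l : ℝ) (_ : 0 < l) => ENNReal.ofReal (φ (a.approx l)).re) l hl)
    (le_iSup₂ (f := fun (l : ℝ) (_ : 0 < l) => ENNReal.ofReal (ψ (a.approx l)).re) l hl))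

theorem eval_smul {c : ℝ} (hc : 0 ≤ c) (φ : Functional M) :
    a.eval (c • φ) = ENNReal.ofReal c * a.eval φ := by
  simp only [eval, ENNReal.mul_iSup]
  refine iSup_congr fun l => iSup_congr fun _ => ?_
  rw [LinearMap.smul_apply, Complex.smul_re, smul_eq_mul, ENNReal.ofReal_mul hc]

theorem zero_mem_Dpos : (0 : Functional M) ∈ a.Dpos := by
  refine ⟨fun x _ => le_rfl, ?_, ?_⟩
  · exact @continuous_const _ _ (ultraweakTopology M) _ 0
  · simp [eval]

theorem add_mem_Dpos {φ ψ : Functional M} (hφ : φ ∈ a.Dpos) (hψ : ψ ∈ a.Dpos) :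
    φ + ψ ∈ a.Dpos := by
  refine ⟨fun x hx => add_nonneg (hφ.1 x hx) (hψ.1 x hx), ?_, ?_⟩
  · let := ultraweakTopology M
    exact Continuous.add (X := M.toStarSubalgebra) hφ.2.1 hψ.2.1
  · exact (a.eval_add_le φ ψ).trans_lt (ENNReal.add_lt_top.2 ⟨hφ.2.2, hψ.2.2⟩)

theorem smul_mem_Dpos {c : ℝ} (hc : 0 ≤ c) {φ : Functional M} (hφ : φ ∈ a.Dpos) :
    c • φ ∈ a.Dpos := by
  refine ⟨fun x hx => smul_nonneg hc (hφ.1 x hx), ?_, ?_⟩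
  · have hc : Continuous fun z : ℂ => c • z := continuous_const_smul c
    exact @Continuous.comp _ _ _ (ultraweakTopology M) _ _ φ (fun z : ℂ => c • z) hc hφ.2.1
  · rw [eval_smul a hc]
    exact ENNReal.mul_lt_top ENNReal.ofReal_lt_top hφ.2.2

/-- `𝔇_a^h = 𝔇_a^+ - 𝔇_a^+`, a real vector space of hermitian normal functionals. -/
def Dh : Submodule ℝ (Functional M) where
  carrier := {φ | ∃ φ₁ ∈ a.Dpos, ∃ φ₂ ∈ a.Dpos, φ = φ₁ - φ₂}
  add_mem' := by
    rintro _ _ ⟨φ₁, h₁, φ₂, h₂, rfl⟩ ⟨ψ₁, k₁, ψ₂, k₂, rfl⟩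
    exact ⟨_, a.add_mem_Dpos h₁ k₁, _, a.add_mem_Dpos h₂ k₂, by abel⟩
  zero_mem' := ⟨0, a.zero_mem_Dpos, 0, a.zero_mem_Dpos, by simp⟩
  smul_mem' := by
    rintro c _ ⟨φ₁, h₁, φ₂, h₂, rfl⟩
    rcases le_total 0 c with hc | hc
    · exact ⟨_, a.smul_mem_Dpos hc h₁, _, a.smul_mem_Dpos hc h₂, smul_sub _ _ _⟩
    · refine ⟨_, a.smul_mem_Dpos (neg_nonneg.2 hc) h₂, _, a.smul_mem_Dpos (neg_nonneg.2 hc) h₁, ?_⟩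
      module

theorem Dpos_subset_Dh {φ : Functional M} (h : φ ∈ a.Dpos) : φ ∈ a.Dh :=
  ⟨φ, h, 0, a.zero_mem_Dpos, by simp⟩

/-- The numbers `φ₁(a) + φ₂(a)` over all decompositions `φ = φ₁ - φ₂` with `φ₁, φ₂ ∈ 𝔇_a^+`. -/
def normSet (φ : Functional M) : Set ℝ :=
  {r | ∃ φ₁ ∈ a.Dpos, ∃ φ₂ ∈ a.Dpos, φ = φ₁ - φ₂ ∧ r = (a.eval φ₁).toReal + (a.eval φ₂).toReal}

/-- `‖φ‖_a = inf {φ₁(a) + φ₂(a) | φ = φ₁ - φ₂, φ₁, φ₂ ∈ 𝔇_a^+}` for `φ ∈ 𝔇_a^h`. -/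
instance instNormDh : Norm a.Dh := ⟨fun φ => sInf (a.normSet φ)⟩

theorem norm_def (φ : a.Dh) : ‖φ‖ = sInf (a.normSet φ) := rfl

theorem normSet_nonneg (φ : Functional M) : ∀ r ∈ a.normSet φ, 0 ≤ r := by
  rintro _ ⟨φ₁, _, φ₂, _, _, rfl⟩
  positivity

theorem normSet_bddBelow (φ : Functional M) : BddBelow (a.normSet φ) := ⟨0, a.normSet_nonneg φ⟩

theorem normSet_nonempty (φ : a.Dh) : (a.normSet φ).Nonempty := by
  obtain ⟨φ₁, h₁, φ₂, h₂, h⟩ := φ.2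
  exact ⟨_, φ₁, h₁, φ₂, h₂, h, rfl⟩

theorem norm_smul_le_aux (c : ℝ) (φ : a.Dh) : ‖c • φ‖ ≤ |c| * ‖φ‖ := by
  rw [norm_def a φ, ← smul_eq_mul, ← Real.sInf_smul_of_nonneg (abs_nonneg c)]
  refine csInf_le_csInf (a.normSet_bddBelow _) ((a.normSet_nonempty φ).smul_set) ?_
  rintro _ ⟨_, ⟨φ₁, h₁, φ₂, h₂, h, rfl⟩, rfl⟩
  have key : ∀ ψ : Functional M, (a.eval (|c| • ψ)).toReal = |c| * (a.eval ψ).toReal := by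
    intro ψ
    rw [eval_smul a (abs_nonneg c), ENNReal.toReal_mul, ENNReal.toReal_ofReal (abs_nonneg c)]
  rcases le_total 0 c with hc | hc
  · refine ⟨_, a.smul_mem_Dpos (abs_nonneg c) h₁, _, a.smul_mem_Dpos (abs_nonneg c) h₂, ?_, ?_⟩
    · rw [abs_of_nonneg hc, ← smul_sub, ← h]; rfl
    · rw [key, key]; simp only [smul_eq_mul]; ring
  · refine ⟨_, a.smul_mem_Dpos (abs_nonneg c) h₂, _, a.smul_mem_Dpos (abs_nonneg c) h₁, ?_, ?_⟩
    · rw [abs_of_nonpos hc, Submodule.coe_smul, h]; module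
    · rw [key, key]; simp only [smul_eq_mul]; ring

theorem seminormCore : SeminormedSpace.Core ℝ a.Dh where
  norm_nonneg φ := Real.sInf_nonneg (a.normSet_nonneg φ)
  norm_smul c φ := by
    refine le_antisymm (a.norm_smul_le_aux c φ) ?_
    rcases eq_or_ne c 0 with rfl | hc
    · rw [norm_zero, zero_mul]; exact Real.sInf_nonneg (a.normSet_nonneg _)
    · have h := a.norm_smul_le_aux c⁻¹ (c • φ)
      rw [inv_smul_smul₀ hc, abs_inv, inv_mul_eq_div, le_div_iff₀ (abs_pos.2 hc)] at h
      rw [Real.norm_eq_abs]; linarith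
  norm_triangle φ ψ := by
    refine le_of_forall_pos_le_add fun ε hε => ?_
    obtain ⟨_, ⟨φ₁, h₁, φ₂, h₂, h, rfl⟩, hφ⟩ :=
      Real.lt_sInf_add_pos (a.normSet_nonempty φ) (half_pos hε)
    obtain ⟨_, ⟨ψ₁, k₁, ψ₂, k₂, k, rfl⟩, hψ⟩ :=
      Real.lt_sInf_add_pos (a.normSet_nonempty ψ) (half_pos hε)
    have key : ∀ {χ ω : Functional M}, χ ∈ a.Dpos → ω ∈ a.Dpos →
        (a.eval (χ + ω)).toReal ≤ (a.eval χ).toReal + (a.eval ω).toReal := by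
      intro χ ω hχ hω
      rw [← ENNReal.toReal_add hχ.2.2.ne hω.2.2.ne]
      exact ENNReal.toReal_mono (ENNReal.add_lt_top.2 ⟨hχ.2.2, hω.2.2⟩).ne (a.eval_add_le χ ω)
    have hle : ‖φ + ψ‖ ≤ (a.eval (φ₁ + ψ₁)).toReal + (a.eval (φ₂ + ψ₂)).toReal := by
      refine csInf_le (a.normSet_bddBelow _)
        ⟨_, a.add_mem_Dpos h₁ k₁, _, a.add_mem_Dpos h₂ k₂, ?_, rfl⟩
      rw [Submodule.coe_add, h, k]; abel
    have e1 := key h₁ k₁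
    have e2 := key h₂ k₂
    rw [norm_def a φ, norm_def a ψ]
    linarith

instance instSeminormedDh : SeminormedAddCommGroup a.Dh := .ofCore a.seminormCore

instance instNormedSpaceDh : NormedSpace ℝ a.Dh where
  norm_smul_le c φ := (a.seminormCore.norm_smul c φ).le

/-! ### The space `L_1(a)` -/

/-- `L_1^h(a)`: the completion of `𝔇_a^h` in the `a`-norm. -/
abbrev L1h := UniformSpace.Completion a.Dh

/-- `a^{1/2} φ a^{1/2}`: the functional `x ↦ lim_{l → ∞} φ(a_l^{1/2} x a_l^{1/2})` on `M`, for
`φ ∈ 𝔇_a^h`. -/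
def sandwich (φ : Functional M) (x : M.toStarSubalgebra) : ℂ :=
  limUnder atTop fun l => φ (a.sqrtApprox l * x * a.sqrtApprox l)

/-- The extension by continuity of `φ ↦ (a^{1/2} φ a^{1/2})(x)` from `𝔇_a^h` to `L_1^h(a)`. -/
def pairH (φ : a.L1h) (x : M.toStarSubalgebra) : ℂ :=
  UniformSpace.Completion.extension (fun ψ : a.Dh => a.sandwich ψ x) φ

/-- `L_1(a)`, the complexification of `L_1^h(a)`: the pair `(φ₁, φ₂)` stands for `φ₁ + i φ₂`. -/
abbrev L1 := a.L1h × a.L1h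

/-- The image in `L_1(a)` of an element of `𝔇_a^h`. -/
def embed (φ : a.Dh) : a.L1 := ((φ : a.L1h), 0)

/-- The functional `a^{1/2} φ a^{1/2}` on `M` for `φ ∈ L_1(a)`; its value at `x` is also the value
at `φ` of the element of `L_∞(a)` given by the form `(f, g) ↦ ⟨x a^{1/2} f, a^{1/2} g⟩`. -/
def pair (φ : a.L1) (x : M.toStarSubalgebra) : ℂ := a.pairH φ.1 x + Complex.I * a.pairH φ.2 x

/-- The norm `‖φ‖_a = ‖a^{1/2} φ a^{1/2}‖` on `L_1(a)`. -/
def normL1 (φ : a.L1) : ℝ :=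
  ⨆ x : {x : M.toStarSubalgebra // ‖(x : H →L[ℂ] H)‖ ≤ 1}, ‖a.pair φ x‖

/-- The sesquilinear form `(f, g) ↦ ⟨x a^{1/2} f, a^{1/2} g⟩` on `D(a^{1/2})`; the elements of
`L_∞(a)` are these forms with `x ∈ M`. -/
def form (x : M.toStarSubalgebra) (f g : a.sqrtOp.domain) : ℂ :=
  inner ℂ (a.sqrtOp g) ((x : H →L[ℂ] H) (a.sqrtOp f))

/-- `L_1^+(a)`: the elements of `L_1(a)` that are nonnegative on every positive form
in `L_∞(a)`. -/
def L1pos : Set a.L1 :=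
  {φ | ∀ x : M.toStarSubalgebra, (∀ f, 0 ≤ a.form x f f) → 0 ≤ a.pair φ x}

end PosAffiliatedOp

end AffiliatedL1

end

/-! The density statement is a Hahn–Banach argument in the real Banach space $L_1^h(a)$. If an
element $\chi$, nonnegative on positive forms, were outside the closure of the cone $\mathfrak
D_a^+$, a real functional $F$ would separate them, and $F\ge 0$ on $\mathfrak D_a^+$ because this is
a cone. Applied to the vector functionals of $\xi\in D(a^{1/2})$ and polarised, $F$ becomes a
positive form on $D(a^{1/2})$ bounded by $\|F\|\,\|a^{1/2}\xi\|^2$. Injectivity of $a$ makes the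
range of $a^{1/2}$ dense (`denseRange_sqrtOp`), so the form is $\langle x
a^{1/2}\xi,a^{1/2}\eta\rangle$ for a bounded $x$. Vector functionals on $M$ do not notice moving an
element of $M'$ from one vector to the other, hence $x\in M$ (`exists_density`). Each member of
$\mathfrak D_a^+$ is an $a$-norm limit of finite sums of vector functionals (`tendsto_sum_vecDh`),
so $F$ is the pairing with $x$; then $F(\chi)\ge 0$, a contradiction (`mem_closure_posCone`).

All this rests on writing a positive normal functional as
$\sum_n\langle\,\cdot\,\zeta_n,\zeta_n\rangle$ (`exists_repr`), a Radon–Nikodym argument on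
$\ell^2(H)$; finiteness of $\varphi(a)$ puts every $\zeta_n$ in $D(a^{1/2})$ with
$\sum_n\|a^{1/2}\zeta_n\|^2<\infty$.

For $\varphi_1+i\varphi_2\in L_1^+(a)$ the pairings of both parts with positive forms are real, so
$\varphi_2$ pairs to $0$ with each of them. It therefore lies in the closed cone, where $\|\chi\|_a$
is at most the pairing with $1$, and vanishes.

The canonical map is injective since $\|\varphi\|_a=0$ kills $\varphi$ on all $a_l^{1/2}ya_l^{1/2}$,
while $l^{-1}a_l\to 1$ strongly as $l\to 0^+$. -/

noncomputable section

namespace AffiliatedL1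

/-! ### Bounded positive forms as bounded operators -/

section FormRepresentation

variable {V K : Type*} [AddCommGroup V] [Module ℂ V]
  [NormedAddCommGroup K] [InnerProductSpace ℂ K] [CompleteSpace K]

/-- A positive semidefinite form on `V` that is bounded with respect to the inner product pulled
back along a linear map `e : V → K` with dense range comes from a bounded operator on `K`. -/
theorem exists_clm_of_form (c : PreInnerProductSpace.Core ℂ V) (e : V →ₗ[ℂ] K)
    (he : DenseRange e) {C : ℝ} (hC : 0 ≤ C)
    (h : ∀ v, (c.inner v v).re ≤ C * ‖e v‖ ^ 2) :
    ∃ T : K →L[ℂ] K, ∀ u v, inner ℂ (e u) (T (e v)) = c.inner u v := by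
  have hn : ∀ v, √(c.inner v v).re ≤ √C * ‖e v‖ := fun v => by
    refine (Real.sqrt_le_sqrt (h v)).trans ?_
    rw [Real.sqrt_mul hC, Real.sqrt_sq (norm_nonneg _)]
  have hb : ∀ u v, ‖c.inner u v‖ ≤ C * ‖e u‖ * ‖e v‖ := fun u v => by
    have h1 : ‖c.inner u v‖ ≤ √(c.inner u u).re * √(c.inner v v).re :=
      InnerProductSpace.Core.norm_inner_le_norm (c := c) u v
    have h2 := mul_le_mul (hn u) (hn v) (Real.sqrt_nonneg _) (by positivity)
    refine (h1.trans h2).trans_eq ?_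
    rw [mul_mul_mul_comm, Real.mul_self_sqrt hC, mul_assoc]
  have addr : ∀ u v w, c.inner u (v + w) = c.inner u v + c.inner u w := fun u v w => by
    rw [← c.conj_inner_symm u (v + w), c.add_left, map_add, c.conj_inner_symm, c.conj_inner_symm]
  have smulr : ∀ (u v) (r : ℂ), c.inner u (r • v) = r * c.inner u v := fun u v r => by
    rw [← c.conj_inner_symm u (r • v), c.smul_left, map_mul, c.conj_inner_symm,
      starRingEnd_self_apply]
  let g : V → V →ₗ[ℂ] ℂ := fun u =>
    { toFun := fun v => c.inner u v, map_add' := addr u, map_smul' := fun r v => smulr u v r }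
  let G : V → StrongDual ℂ K := fun u => (g u).extendOfNorm e
  have hG : ∀ u v, G u (e v) = c.inner u v := fun u =>
    LinearMap.extendOfNorm_eq (f := g u) he ⟨C * ‖e u‖, hb u⟩
  have hGn : ∀ u, ‖G u‖ ≤ C * ‖e u‖ := fun u =>
    ContinuousLinearMap.opNorm_le_bound _ (by positivity)
      (LinearMap.norm_extendOfNorm_apply_le (f := g u) he _ (hb u))
  -- The Riesz vector of the extended functional $c(u,\cdot)$. It depends linearly on $u$, since
  -- both $c$ and the inner product are conjugate linear on the left, so it extends to an operator
  -- on $K$; conjugate symmetry then moves this operator to the right-hand argument.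
  let R : V → K := fun u => (InnerProductSpace.toDual ℂ K).symm (G u)
  have hR : ∀ u v, inner ℂ (R u) (e v) = c.inner u v := fun u v => by
    rw [InnerProductSpace.toDual_symm_apply, hG]
  have ext : ∀ {x y : K}, (∀ v, inner ℂ x (e v) = inner ℂ y (e v)) → x = y := fun {x y} hxy => by
    refine ext_inner_right ℂ fun k => ?_
    exact congrFun (he.equalizer (by fun_prop) (by fun_prop) (funext hxy)) k
  let L : V →ₗ[ℂ] K :=
    { toFun := R
      map_add' := fun u w => ext fun v => by rw [hR, inner_add_left, hR, hR, c.add_left]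
      map_smul' := fun r u => ext fun v => by
        rw [RingHom.id_apply, hR, inner_smul_left, hR, c.smul_left] }
  have hL : ∀ u, ‖L u‖ ≤ C * ‖e u‖ := fun u => by
    change ‖(InnerProductSpace.toDual ℂ K).symm (G u)‖ ≤ _
    rw [LinearIsometryEquiv.norm_map]; exact hGn u
  refine ⟨L.extendOfNorm e, fun u v => ?_⟩
  rw [LinearMap.extendOfNorm_eq he ⟨C, hL⟩, ← c.conj_inner_symm u v, ← hR v u, inner_conj_symm]
  rfl

end FormRepresentation

/-! ### Positive normal functionals as sums of vector functionals -/

section Normal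

variable {H : Type*} [NormedAddCommGroup H] [InnerProductSpace ℂ H]

/-- The Hilbert space of square summable sequences in `H`. -/
abbrev SqSum (H : Type*) [NormedAddCommGroup H] [InnerProductSpace ℂ H] := lp (fun _ : ℕ => H) 2

/-- The diagonal operator on square summable sequences. -/
def diag (y : H →L[ℂ] H) : SqSum H →L[ℂ] SqSum H :=
  lp.mapCLM 2 (fun _ => y) (norm_nonneg y) fun _ => le_rfl

theorem diag_apply (y : H →L[ℂ] H) (k : SqSum H) (n : ℕ) : diag y k n = y (k n) := by
  simp [diag]

theorem re_inner_le_of_le {A B : H →L[ℂ] H} (h : A ≤ B) (f : H) :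
    (inner ℂ f (A f)).re ≤ (inner ℂ f (B f)).re := by
  have h1 := (Complex.le_def.1 (((ContinuousLinearMap.le_def _ _).1 h).inner_nonneg_right f)).1
  rw [sub_apply, inner_sub_right, Complex.sub_re, Complex.zero_re] at h1
  linarith

theorem summable_norm_sq (ζ : SqSum H) : Summable fun n => ‖ζ n‖ ^ 2 := by
  have h2 : 0 < (2 : ℝ≥0∞).toReal := by norm_num
  simpa using (memℓp_gen_iff h2).1 (lp.memℓp ζ)

theorem norm_inner_apply_le (y : H →L[ℂ] H) (f : H) : ‖inner ℂ f (y f)‖ ≤ ‖y‖ * ‖f‖ ^ 2 := by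
  refine (norm_inner_le_norm _ _).trans ?_
  rw [sq, mul_left_comm]
  exact mul_le_mul_of_nonneg_left (y.le_opNorm f) (norm_nonneg _)

theorem diag_mul (x y : H →L[ℂ] H) (k : SqSum H) : diag (x * y) k = diag x (diag y k) := by
  ext n; simp [diag_apply]

theorem diag_add (x y : H →L[ℂ] H) (k : SqSum H) : diag (x + y) k = diag x k + diag y k := by
  ext n; simp [diag_apply]

theorem diag_smul (c : ℂ) (y : H →L[ℂ] H) (k : SqSum H) : diag (c • y) k = c • diag y k := by
  ext n; simp [diag_apply]

theorem inner_diag (y : H →L[ℂ] H) (k l : SqSum H) :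
    inner ℂ k (diag y l) = ∑' n, inner ℂ (k n) (y (l n)) := by
  rw [lp.inner_eq_tsum]; simp only [diag_apply]

theorem inner_diag_self_nonneg {y : H →L[ℂ] H} (hy : y.IsPositive) (k : SqSum H) :
    0 ≤ inner ℂ k (diag y k) := by
  rw [inner_diag]
  exact tsum_nonneg fun n => hy.inner_nonneg_right _

theorem isPositive_of_inner_nonneg {K : Type*} [NormedAddCommGroup K] [InnerProductSpace ℂ K]
    {T : K →L[ℂ] K} (h : ∀ k, 0 ≤ inner ℂ k (T k)) : T.IsPositive := by
  rw [ContinuousLinearMap.isPositive_iff_complex]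
  intro k
  have h1 := h k
  have h2 := inner_conj_symm (𝕜 := ℂ) (T k) k
  have h3 : inner ℂ (T k) k = inner ℂ k (T k) := by
    rw [← h2]; exact Complex.conj_eq_iff_im.2 (Complex.le_def.1 h1).2.symm
  rw [h3]
  obtain ⟨p, q⟩ := Complex.le_def.1 h1
  exact ⟨Complex.ext rfl q, p⟩

theorem exists_commuting_sqrt {K : Type*} [NormedAddCommGroup K] [InnerProductSpace ℂ K]
    [CompleteSpace K] {T : K →L[ℂ] K} (hT : T.IsPositive) :
    ∃ S : K →L[ℂ] K, star S = S ∧ S * S = T ∧ ∀ B, Commute T B → Commute S B := by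
  have hT0 : 0 ≤ T := (ContinuousLinearMap.nonneg_iff_isPositive T).2 hT
  exact ⟨CFC.sqrt T, (CFC.sqrt_nonneg T).isSelfAdjoint.star_eq, CFC.sqrt_mul_sqrt_self T,
    fun B hB => hB.cfcₙ_nnreal NNReal.sqrt⟩

/-- Two sequences are interleaved along a bijection $\mathbb N\sqcup\mathbb N\simeq\mathbb N$. This
makes the functionals $\sum_n\langle\,\cdot\,\xi_n,\eta_n\rangle$ closed under addition. -/
theorem exists_sqSum_merge (ξ η ξ' η' : SqSum H) : ∃ ζ θ : SqSum H, ∀ y : H →L[ℂ] H,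
    inner ℂ θ (diag y ζ) = inner ℂ η (diag y ξ) + inner ℂ η' (diag y ξ') := by
  let e := Equiv.natSumNatEquivNat
  have hm : ∀ u v : SqSum H, Memℓp (fun n => (Sum.elim u v (e.symm n) : H)) 2 := fun u v => by
    have h2 : 0 < (2 : ℝ≥0∞).toReal := by norm_num
    rw [memℓp_gen_iff h2, ← e.summable_iff]
    refine Summable.sum _ ?_ ?_
    · simpa [Function.comp_def] using (memℓp_gen_iff h2).1 (lp.memℓp u)
    · simpa [Function.comp_def] using (memℓp_gen_iff h2).1 (lp.memℓp v)
  refine ⟨⟨_, hm ξ ξ'⟩, ⟨_, hm η η'⟩, fun y => ?_⟩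
  have s1 := lp.summable_inner (𝕜 := ℂ) η (diag y ξ)
  have s2 := lp.summable_inner (𝕜 := ℂ) η' (diag y ξ')
  rw [inner_diag, inner_diag, inner_diag, ← e.tsum_eq, Summable.tsum_sum]
  · simp
  · simpa [Function.comp_def, diag_apply] using s1
  · simpa [Function.comp_def, diag_apply] using s2

variable [CompleteSpace H]

theorem inner_diag_right (y : H →L[ℂ] H) (k l : SqSum H) :
    inner ℂ k (diag y l) = inner ℂ (diag (star y) k) l := by
  rw [lp.inner_eq_tsum, lp.inner_eq_tsum]
  refine tsum_congr fun n => ?_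
  rw [diag_apply, diag_apply, ContinuousLinearMap.star_eq_adjoint,
    ContinuousLinearMap.adjoint_inner_left]

variable {M : VonNeumannAlgebra H}

/-- A functional continuous for the weak topology of a family of functionals lies in the linear span
of that family, and here the span is the family itself. -/
theorem IsNormal.exists_inner {φ : Functional M} (h : IsNormal φ) :
    ∃ ξ η : SqSum H, ∀ y : M.toStarSubalgebra, φ y = inner ℂ η (diag (y : H →L[ℂ] H) ξ) := by
  let f : SqSum H × SqSum H → Functional M := fun p =>
    { toFun := fun y => inner ℂ p.2 (diag (y : H →L[ℂ] H) p.1)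
      map_add' := fun x y => by
        rw [← inner_add_right, ← diag_add]; rfl
      map_smul' := fun c y => by
        rw [RingHom.id_apply, smul_eq_mul, ← inner_smul_right, ← diag_smul]; rfl }
  have hs : φ ∈ Submodule.span ℂ (Set.range f) := by
    rw [LinearMap.mem_span_iff_continuous]
    have e : ultraweakTopology M = ⨅ i, TopologicalSpace.induced (f i) inferInstance := by
      rw [iInf_prod]
      refine iInf_congr fun ξ => iInf_congr fun η => ?_
      have : (fun x : M.toStarSubalgebra => ∑' n, inner ℂ (η n) ((x : H →L[ℂ] H) (ξ n)))
          = fun x => f (ξ, η) x := funext fun y => (inner_diag _ _ _).symm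
      rw [this]
    rw [← e]; exact h
  clear h
  induction hs using Submodule.span_induction with
  | mem x hx => obtain ⟨p, rfl⟩ := hx; exact ⟨p.1, p.2, fun y => rfl⟩
  | zero => exact ⟨0, 0, fun y => by simp⟩
  | add x y _ _ hx hy =>
    obtain ⟨ξ, η, h1⟩ := hx
    obtain ⟨ξ', η', h2⟩ := hy
    obtain ⟨ζ, θ, h3⟩ := exists_sqSum_merge ξ η ξ' η'
    exact ⟨ζ, θ, fun z => by rw [h3, LinearMap.add_apply, h1, h2]⟩
  | smul c x _ hx =>
    obtain ⟨ξ, η, h1⟩ := hx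
    exact ⟨c • ξ, η, fun z => by
      rw [LinearMap.smul_apply, h1, map_smul, inner_smul_right, smul_eq_mul]⟩

theorem IsPos.star_mul_self_nonneg {φ : Functional M} (hp : IsPos φ) (x : M.toStarSubalgebra) :
    0 ≤ φ (star x * x) := by
  refine hp _ ?_
  have := ContinuousLinearMap.isPositive_adjoint_comp_self (x : H →L[ℂ] H)
  exact this

/-- Polarisation: $\varphi(z^*z)$ is real for $z=x+y$, which settles the imaginary parts, and for
$z=x+iy$, which settles the real parts. -/
theorem IsPos.conj_star_mul {φ : Functional M} (hp : IsPos φ) (x y : M.toStarSubalgebra) :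
    (starRingEnd ℂ) (φ (star y * x)) = φ (star x * y) := by
  have him : ∀ z, (φ (star z * z)).im = 0 := fun z =>
    (Complex.le_def.1 (hp.star_mul_self_nonneg z)).2.symm
  have h1 := him (x + y)
  have h2 := him (x + Complex.I • y)
  have e1 : star (x + y) * (x + y)
      = star x * x + star x * y + star y * x + star y * y := by
    rw [star_add]; noncomm_ring
  have e2 : star (x + Complex.I • y) * (x + Complex.I • y)
      = star x * x + Complex.I • (star x * y) - Complex.I • (star y * x) + star y * y := by
    rw [star_add, star_smul, add_mul, mul_add, mul_add, smul_mul_assoc, smul_mul_assoc,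
      mul_smul_comm, mul_smul_comm, smul_smul]
    simp only [RCLike.star_def, Complex.conj_I, neg_mul, Complex.I_mul_I, neg_neg, one_smul,
      neg_smul]
    abel
  rw [e1] at h1
  rw [e2] at h2
  simp only [map_add, map_sub, map_smul, smul_eq_mul, Complex.add_im, Complex.sub_im,
    Complex.mul_im, Complex.I_re, Complex.I_im, him] at h1 h2
  apply Complex.ext
  · rw [Complex.conj_re]; linarith
  · rw [Complex.conj_im]; linarith

/-- With $q(k)=\langle yk,k\rangle\ge 0$, polarisation gives $4\,\mathrm{Re}\langle
y\xi,\eta\rangle=q(\xi+\eta)-q(\xi-\eta)\le q(\xi+\eta)$, so $\zeta=(\xi+\eta)/2$ works. -/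
theorem IsNormal.exists_dominating {φ : Functional M} (hn : IsNormal φ) :
    ∃ ζ : SqSum H, ∀ y : M.toStarSubalgebra, (y : H →L[ℂ] H).IsPositive →
      (φ y).re ≤ (inner ℂ ζ (diag (y : H →L[ℂ] H) ζ)).re := by
  obtain ⟨ξ, η, h⟩ := hn.exists_inner
  refine ⟨(1 / 2 : ℂ) • (ξ + η), fun y hy => ?_⟩
  have h1 := (Complex.le_def.1 (inner_diag_self_nonneg hy (ξ - η))).1
  have h2 : inner ℂ ξ (diag (y : H →L[ℂ] H) η)
      = (starRingEnd ℂ) (inner ℂ η (diag (y : H →L[ℂ] H) ξ)) := by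
    rw [inner_diag_right, hy.isSelfAdjoint.star_eq, inner_conj_symm]
  rw [h]
  rw [map_sub, inner_sub_left, inner_sub_right, inner_sub_right, h2] at h1
  rw [map_smul, map_add, inner_smul_left, inner_smul_right, inner_add_left, inner_add_right,
    inner_add_right, h2]
  have e : (starRingEnd ℂ) (1 / 2 : ℂ) = ((1 / 2 : ℝ) : ℂ) := by
    rw [← Complex.conj_ofReal]; norm_num
  have e' : (1 / 2 : ℂ) = ((1 / 2 : ℝ) : ℂ) := by norm_num
  rw [e, e', Complex.re_ofReal_mul, Complex.re_ofReal_mul]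
  simp only [Complex.add_re, Complex.sub_re, Complex.conj_re, Complex.zero_re] at h1 ⊢
  linarith

/-- A positive functional dominated by a vector functional on sequences is given by a positive
operator commuting with the diagonal action. -/
theorem exists_commuting_density {φ : Functional M} (hp : IsPos φ) {ζ : SqSum H}
    (hζ : ∀ y : M.toStarSubalgebra, (y : H →L[ℂ] H).IsPositive →
      (φ y).re ≤ (inner ℂ ζ (diag (y : H →L[ℂ] H) ζ)).re) :
    ∃ T : SqSum H →L[ℂ] SqSum H, T.IsPositive ∧
      (∀ y : M.toStarSubalgebra, Commute T (diag (y : H →L[ℂ] H))) ∧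
      ∀ y : M.toStarSubalgebra, φ y = inner ℂ ζ (T (diag (y : H →L[ℂ] H) ζ)) := by
  let J : M.toStarSubalgebra →ₗ[ℂ] SqSum H :=
    { toFun := fun y => diag (y : H →L[ℂ] H) ζ
      map_add' := fun x y => diag_add _ _ _
      map_smul' := fun c y => diag_smul _ _ _ }
  have hJ : ∀ x y, J (x * y) = diag (x : H →L[ℂ] H) (J y) := fun x y => diag_mul _ _ _
  let N := LinearMap.range J
  let e : M.toStarSubalgebra →ₗ[ℂ] N.topologicalClosure :=
    J.codRestrict _ fun y => N.le_topologicalClosure ⟨y, rfl⟩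
  have he : DenseRange e := by
    intro k
    rw [closure_subtype]
    have : (Subtype.val '' Set.range e : Set (SqSum H)) = N := by
      rw [← Set.range_comp]; rfl
    rw [this]
    exact k.2
  let c : PreInnerProductSpace.Core ℂ M.toStarSubalgebra :=
    { inner := fun x y => φ (star x * y)
      conj_inner_symm := fun x y => hp.conj_star_mul x y
      re_inner_nonneg := fun x => (Complex.le_def.1 (hp.star_mul_self_nonneg x)).1
      add_left := fun x y z => by
        change φ _ = φ _ + φ _
        rw [star_add, add_mul, map_add]
      smul_left := fun x y r => by
        change φ _ = _ * φ _
        rw [star_smul, smul_mul_assoc, map_smul]; rfl }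
  -- Domination says $\varphi(v^*v)\le\|v\zeta\|^2$, so the GNS form of $\varphi$ is bounded on the
  -- cyclic subspace generated by $\zeta$.
  obtain ⟨T₀, hT₀'⟩ := exists_clm_of_form c e he zero_le_one (fun v => by
    have h1 := hζ (star v * v) (ContinuousLinearMap.isPositive_adjoint_comp_self (v : H →L[ℂ] H))
    have h2 : inner ℂ ζ (diag ((star v * v : M.toStarSubalgebra) : H →L[ℂ] H) ζ)
        = inner ℂ (J v) (J v) := by
      change inner ℂ ζ (J (star v * v)) = _
      rw [hJ, inner_diag_right]
      change inner ℂ (diag (star (star (v : H →L[ℂ] H))) ζ) _ = _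
      rw [star_star]; rfl
    rw [h2, inner_self_eq_norm_sq_to_K] at h1
    rw [one_mul]
    refine h1.trans_eq ?_
    change ((‖J v‖ : ℂ) ^ 2).re = ‖J v‖ ^ 2
    rw [← Complex.ofReal_pow, Complex.ofReal_re])
  have hT₀ : ∀ u v, inner ℂ (e u) (T₀ (e v)) = φ (star u * v) := hT₀'
  have hT₀pos : T₀.IsPositive := isPositive_of_inner_nonneg fun k => by
    refine he.induction_on k ?_ fun v => ?_
    · exact isClosed_le continuous_const (by fun_prop)
    · rw [hT₀]; exact hp.star_mul_self_nonneg v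
  let ι := N.topologicalClosure.subtypeL
  -- $T_0$ on the closure of $N$, extended by $0$ on $N^\perp$.
  let T : SqSum H →L[ℂ] SqSum H := ι ∘L T₀ ∘L ContinuousLinearMap.adjoint ι
  have hTpos : T.IsPositive := hT₀pos.conj_adjoint ι
  have hTJ : ∀ u v, inner ℂ (J u) (T (J v)) = φ (star u * v) := fun u v => by
    have e1 : ∀ w, ContinuousLinearMap.adjoint ι (J w) = e w := fun w => by
      refine ext_inner_right ℂ fun k => ?_
      rw [ContinuousLinearMap.adjoint_inner_left]; rfl
    change inner ℂ (J u) (ι (T₀ (ContinuousLinearMap.adjoint ι (J v)))) = _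
    rw [← ContinuousLinearMap.adjoint_inner_left, e1, e1, hT₀]
  have hTmem : ∀ k, T k ∈ N.topologicalClosure := fun k => (T₀ _).2
  have hTorth : ∀ k ∈ Nᗮ, T k = 0 := fun k hk => by
    have : ContinuousLinearMap.adjoint ι k = 0 := by
      refine ext_inner_right ℂ fun l => ?_
      rw [ContinuousLinearMap.adjoint_inner_left, inner_zero_left]
      rw [← Submodule.orthogonal_closure] at hk
      exact (Submodule.mem_orthogonal' _ _).1 hk _ l.2
    change ι (T₀ (ContinuousLinearMap.adjoint ι k)) = 0
    rw [this, map_zero, map_zero]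
  have hdorth : ∀ (y : M.toStarSubalgebra), ∀ k ∈ Nᗮ, diag (y : H →L[ℂ] H) k ∈ Nᗮ := by
    rintro y k hk
    rw [Submodule.mem_orthogonal]
    rintro _ ⟨v, rfl⟩
    rw [inner_diag_right]
    exact (Submodule.mem_orthogonal _ _).1 hk _ ⟨star y * v, hJ (star y) v⟩
  have hcomm : ∀ y : M.toStarSubalgebra, Commute T (diag (y : H →L[ℂ] H)) := by
    intro y
    let W := T * diag (y : H →L[ℂ] H) - diag (y : H →L[ℂ] H) * T
    -- The commutator maps $N$ into $N^\perp$, because $\varphi(u^*(yv))=\varphi((y^*u)^*v)$, and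
    -- into $N^{\perp\perp}$, because $T$ has range in the closure of $N$ and the diagonal action
    -- preserves $N^\perp$.
    have hW1 : N ≤ LinearMap.ker W.toLinearMap := by
      rintro _ ⟨v, rfl⟩
      have m1 : W (J v) ∈ Nᗮ := by
        rw [Submodule.mem_orthogonal]
        rintro _ ⟨u, rfl⟩
        change inner ℂ (J u) (T (diag (y : H →L[ℂ] H) (J v))
          - diag (y : H →L[ℂ] H) (T (J v))) = 0
        rw [inner_sub_right, ← hJ, hTJ, inner_diag_right]
        change _ - inner ℂ (diag ((star y : M.toStarSubalgebra) : H →L[ℂ] H) (J u)) _ = 0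
        rw [← hJ, hTJ, star_mul, star_star, mul_assoc, sub_self]
      have m2 : W (J v) ∈ Nᗮᗮ := by
        rw [Submodule.mem_orthogonal]
        intro k hk
        change inner ℂ k (T (diag (y : H →L[ℂ] H) (J v))
          - diag (y : H →L[ℂ] H) (T (J v))) = 0
        rw [inner_sub_right, inner_diag_right]
        have hk' := hdorth (star y) k hk
        rw [← Submodule.orthogonal_closure] at hk hk'
        rw [(Submodule.mem_orthogonal' _ _).1 hk _ (hTmem _)]
        have := (Submodule.mem_orthogonal' _ _).1 hk' _ (hTmem (J v))
        rw [zero_sub, neg_eq_zero]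
        exact this
      have : W (J v) ∈ Nᗮ ⊓ Nᗮᗮ := ⟨m1, m2⟩
      rwa [Submodule.inf_orthogonal_eq_bot, Submodule.mem_bot] at this
    have hW2 : Nᗮ ≤ LinearMap.ker W.toLinearMap := by
      intro k hk
      change T (diag (y : H →L[ℂ] H) k) - diag (y : H →L[ℂ] H) (T k) = 0
      rw [hTorth k hk, hTorth _ (hdorth y k hk), map_zero, sub_zero]
    have hker : LinearMap.ker W.toLinearMap = ⊤ := by
      rw [eq_top_iff, ← Submodule.sup_orthogonal_of_hasOrthogonalProjection
        (K := N.topologicalClosure), Submodule.orthogonal_closure]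
      exact sup_le (N.topologicalClosure_minimal hW1 W.isClosed_ker) hW2
    refine sub_eq_zero.1 (show W = 0 from ?_)
    ext1 k
    exact LinearMap.mem_ker.1 (hker ▸ Submodule.mem_top (x := k))
  refine ⟨T, hTpos, hcomm, fun y => ?_⟩
  have h1 : ζ = J 1 := by
    change ζ = diag (1 : H →L[ℂ] H) ζ
    ext n; simp [diag_apply]
  have h2 := hTJ 1 y
  rw [← h1, star_one, one_mul] at h2
  exact h2.symm

/-- A positive normal functional is given by a square summable sequence of vectors. -/
theorem exists_repr {φ : Functional M} (hp : IsPos φ) (hn : IsNormal φ) :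
    ∃ ζ : SqSum H, ∀ y : M.toStarSubalgebra, φ y = inner ℂ ζ (diag (y : H →L[ℂ] H) ζ) := by
  obtain ⟨ζ, hζ⟩ := hn.exists_dominating
  obtain ⟨T, hTpos, hcomm, hT⟩ := exists_commuting_density hp hζ
  obtain ⟨S, hs, hss, hc⟩ := exists_commuting_sqrt hTpos
  -- Since $S=T^{1/2}$ commutes with the diagonal action, $\langle\zeta,Ty\zeta\rangle=\langle
  -- S\zeta,yS\zeta\rangle$.
  refine ⟨S ζ, fun y => ?_⟩
  have h2 : diag (y : H →L[ℂ] H) (S ζ) = S (diag (y : H →L[ℂ] H) ζ) :=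
    (congrArg (fun A : SqSum H →L[ℂ] SqSum H => A ζ) (hc _ (hcomm y)).eq).symm
  rw [h2, ← ContinuousLinearMap.adjoint_inner_right, ← ContinuousLinearMap.star_eq_adjoint, hs,
    hT, ← hss]
  rfl

end Normal

end AffiliatedL1

end

/-! ### Bounded approximations of `a` and its square root -/

noncomputable section

namespace AffiliatedL1

namespace PosAffiliatedOp

variable {H : Type*} [NormedAddCommGroup H] [InnerProductSpace ℂ H] [CompleteSpace H]
  {M : VonNeumannAlgebra H} (a : PosAffiliatedOp M)

/-! ### Resolvents -/

theorem inner_op_symm (x y : a.op.domain) :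
    inner ℂ (a.op x) (y : H) = inner ℂ (x : H) (a.op y) := by
  have h := LinearPMap.adjoint_isFormalAdjoint a.selfAdjoint.dense_domain
  rw [LinearPMap.isSelfAdjoint_def.1 a.selfAdjoint] at h
  exact h x y

theorem resolvent_eq {l : ℝ} (hl : 0 < l) {f : H} {w : a.op.domain} (h : a.shift l w = f) :
    a.resolvent l hl f = w :=
  congrArg Subtype.val (a.eq_of_shift_eq hl ((a.resolvent_spec l hl f).2.trans h.symm))

theorem eq_zero_of_resolvent_eq_zero {l : ℝ} (hl : 0 < l) {f : H} (h : a.resolvent l hl f = 0) :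
    f = 0 := by
  obtain ⟨w, rfl⟩ := a.shift_surjective hl f
  rw [a.resolvent_eq hl rfl] at h
  have : w = 0 := Subtype.ext h
  rw [this, map_zero]

theorem inner_resolvent (l : ℝ) (hl : 0 < l) (f g : H) :
    inner ℂ (a.resolvent l hl f) g = inner ℂ f (a.resolvent l hl g) := by
  obtain ⟨u, rfl⟩ := a.shift_surjective hl f
  obtain ⟨w, rfl⟩ := a.shift_surjective hl g
  rw [a.resolvent_eq hl rfl, a.resolvent_eq hl rfl, shift_apply, shift_apply, inner_add_left,
    inner_add_right, inner_smul_left, inner_smul_right, inner_op_symm, Complex.conj_ofReal]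

/-- Writing $f=(m+a)v$ and $v=(l+a)w$, one has also $f=(l+a)(m+a)w$, so both products send $f$ to
$w$. -/
theorem commute_resolvent (l m : ℝ) (hl : 0 < l) (hm : 0 < m) :
    Commute (a.resolvent l hl) (a.resolvent m hm) := by
  refine ContinuousLinearMap.ext fun f => ?_
  change a.resolvent l hl (a.resolvent m hm f) = a.resolvent m hm (a.resolvent l hl f)
  obtain ⟨v, rfl⟩ := a.shift_surjective hm f
  obtain ⟨w, hw⟩ := a.shift_surjective hl (v : H)
  rw [a.resolvent_eq hm rfl, a.resolvent_eq hl hw]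
  rw [shift_apply] at hw
  have hawm : a.op w ∈ a.op.domain := by
    rw [← eq_sub_iff_add_eq] at hw
    rw [hw]
    exact sub_mem v.2 (a.op.domain.smul_mem _ w.2)
  set y : a.op.domain := ⟨a.op w, hawm⟩ with hy
  have hvy : v = y + (l : ℂ) • w := Subtype.ext hw.symm
  have e1 : a.resolvent l hl (a.shift m v) = ((y + (m : ℂ) • w : a.op.domain) : H) := by
    refine a.resolvent_eq hl ?_
    rw [shift_apply, shift_apply, hvy]
    simp only [LinearPMap.map_add, LinearPMap.map_smul, Submodule.coe_add, Submodule.coe_smul]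
    change a.op y + (m : ℂ) • (y : H) + (l : ℂ) • ((y : H) + (m : ℂ) • (w : H))
      = a.op y + (l : ℂ) • (y : H) + (m : ℂ) • ((y : H) + (l : ℂ) • (w : H))
    module
  rw [e1]
  exact (a.resolvent_eq hm (by rw [shift_apply]; rfl)).symm

theorem norm_smul_resolvent_le (l : ℝ) (hl : 0 < l) (f : H) :
    l * ‖a.resolvent l hl f‖ ≤ ‖f‖ := by
  obtain ⟨w, rfl⟩ := a.shift_surjective hl f
  rw [a.resolvent_eq hl rfl]
  exact a.lower_bound l w

/-! ### The bounded approximations -/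

theorem approx_of_pos {l : ℝ} (hl : 0 < l) :
    (a.approx l : H →L[ℂ] H) = (l : ℂ) • (1 - (l : ℂ) • a.resolvent l hl) := by
  rw [approx, dif_pos hl]; rfl

theorem approx_of_nonpos {l : ℝ} (hl : l ≤ 0) : a.approx l = 0 := dif_neg hl.not_gt

theorem approx_isPositive (l : ℝ) : (a.approx l : H →L[ℂ] H).IsPositive := by
  rcases le_or_gt l 0 with hl | hl
  · rw [a.approx_of_nonpos hl]; exact ContinuousLinearMap.isPositive_zero
  refine isPositive_of_inner_nonneg fun f => ?_
  obtain ⟨w, rfl⟩ := a.shift_surjective hl f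
  have hw : (⟨a.resolvent l hl (a.shift l w), (a.resolvent_spec l hl _).1⟩ : a.op.domain) = w :=
    Subtype.ext (a.resolvent_eq hl rfl)
  rw [a.approx_apply l hl, hw, shift_apply, inner_smul_right, inner_add_left, inner_smul_left,
    Complex.conj_ofReal]
  have q : (0 : ℂ) ≤ l := by exact_mod_cast hl.le
  have p : (0 : ℂ) ≤ inner ℂ (a.op w) (a.op w) := by
    rw [inner_self_eq_norm_sq_to_K]
    have h : (0 : ℂ) ≤ ((‖a.op w‖ ^ 2 : ℝ) : ℂ) := Complex.zero_le_real.2 (sq_nonneg _)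
    rwa [Complex.ofReal_pow] at h
  exact mul_nonneg q (add_nonneg p (mul_nonneg q (a.nonneg w)))

theorem approx_nonneg (l : ℝ) : 0 ≤ (a.approx l : H →L[ℂ] H) :=
  (ContinuousLinearMap.nonneg_iff_isPositive _).2 (a.approx_isPositive l)

theorem approx_mono {l m : ℝ} (hlm : l ≤ m) :
    (a.approx l : H →L[ℂ] H) ≤ (a.approx m : H →L[ℂ] H) := by
  rcases le_or_gt l 0 with hl | hl
  · rw [a.approx_of_nonpos hl]; exact a.approx_nonneg m
  · exact (ContinuousLinearMap.le_def _ _).2 (a.approx_sub_isPositive hl hlm)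

theorem commute_approx_resolvent (l m : ℝ) (hm : 0 < m) :
    Commute (a.approx l : H →L[ℂ] H) (a.resolvent m hm) := by
  rcases le_or_gt l 0 with hl | hl
  · rw [a.approx_of_nonpos hl]; exact Commute.zero_left _
  · rw [a.approx_of_pos hl]
    exact ((Commute.one_left _).sub_left ((a.commute_resolvent l m hl hm).smul_left _)).smul_left _

theorem commute_approx (l m : ℝ) : Commute (a.approx l : H →L[ℂ] H) (a.approx m : H →L[ℂ] H) := by
  rcases le_or_gt m 0 with hm | hm
  · rw [a.approx_of_nonpos hm]; exact Commute.zero_right _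
  · rw [a.approx_of_pos hm]
    exact ((Commute.one_right _).sub_right
      ((a.commute_approx_resolvent l m hm).smul_right _)).smul_right _

theorem sqrtApprox_nonneg (l : ℝ) : 0 ≤ (a.sqrtApprox l : H →L[ℂ] H) :=
  CFC.sqrt_nonneg (a.approx l : H →L[ℂ] H)

theorem star_sqrtApprox (l : ℝ) : star (a.sqrtApprox l : H →L[ℂ] H) = a.sqrtApprox l :=
  (a.sqrtApprox_nonneg l).isSelfAdjoint.star_eq

theorem sqrtApprox_mul_self (l : ℝ) :
    (a.sqrtApprox l : H →L[ℂ] H) * a.sqrtApprox l = a.approx l :=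
  CFC.sqrt_mul_sqrt_self (a.approx l : H →L[ℂ] H) (a.approx_nonneg l)

theorem commute_sqrtApprox_of_commute {l : ℝ} {b : H →L[ℂ] H}
    (h : Commute (a.approx l : H →L[ℂ] H) b) : Commute (a.sqrtApprox l : H →L[ℂ] H) b :=
  h.cfcₙ_nnreal NNReal.sqrt

theorem commute_sqrtApprox (l m : ℝ) :
    Commute (a.sqrtApprox l : H →L[ℂ] H) (a.sqrtApprox m : H →L[ℂ] H) :=
  a.commute_sqrtApprox_of_commute (a.commute_sqrtApprox_of_commute (a.commute_approx m l)).symm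

theorem sqrtApprox_mono {l m : ℝ} (hlm : l ≤ m) :
    (a.sqrtApprox l : H →L[ℂ] H) ≤ (a.sqrtApprox m : H →L[ℂ] H) :=
  CFC.sqrt_le_sqrt _ _ (a.approx_mono hlm)

/-- The product of the commuting positive operators $a_l^{1/2}$ and $a_m^{1/2}-a_l^{1/2}$ is
positive. -/
theorem approx_le_mul {l m : ℝ} (hlm : l ≤ m) :
    (a.approx l : H →L[ℂ] H) ≤ (a.sqrtApprox l : H →L[ℂ] H) * a.sqrtApprox m := by
  have h := Commute.mul_nonneg (a.sqrtApprox_nonneg l) (sub_nonneg.2 (a.sqrtApprox_mono hlm))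
    ((a.commute_sqrtApprox l m).sub_right (Commute.refl _))
  rwa [mul_sub, sqrtApprox_mul_self, sub_nonneg] at h

theorem inner_sqrtApprox (l : ℝ) (f g : H) :
    inner ℂ ((a.sqrtApprox l : H →L[ℂ] H) f) g = inner ℂ f ((a.sqrtApprox l : H →L[ℂ] H) g) := by
  rw [← ContinuousLinearMap.adjoint_inner_right, ← ContinuousLinearMap.star_eq_adjoint,
    star_sqrtApprox]

theorem inner_approx (l : ℝ) (f g : H) : inner ℂ f ((a.approx l : H →L[ℂ] H) g)
    = inner ℂ ((a.sqrtApprox l : H →L[ℂ] H) f) ((a.sqrtApprox l : H →L[ℂ] H) g) := by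
  rw [inner_sqrtApprox, ← sqrtApprox_mul_self]; rfl

theorem inner_approx_self (l : ℝ) (f : H) : (inner ℂ f ((a.approx l : H →L[ℂ] H) f) : ℂ)
    = ((‖(a.sqrtApprox l : H →L[ℂ] H) f‖ ^ 2 : ℝ) : ℂ) := by
  rw [inner_approx, inner_self_eq_norm_sq_to_K, Complex.ofReal_pow]; rfl

theorem norm_sqrtApprox_sq (l : ℝ) (f : H) :
    ‖(a.sqrtApprox l : H →L[ℂ] H) f‖ ^ 2 = (inner ℂ f ((a.approx l : H →L[ℂ] H) f)).re := by
  rw [inner_approx_self, Complex.ofReal_re]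

theorem norm_sqrtApprox_mono (f : H) : Monotone fun l => ‖(a.sqrtApprox l : H →L[ℂ] H) f‖ := by
  intro l m hlm
  refine le_of_sq_le_sq ?_ (norm_nonneg _)
  rw [norm_sqrtApprox_sq, norm_sqrtApprox_sq]
  exact re_inner_le_of_le (a.approx_mono hlm) f

/-- In the expanded square, the real part of the inner product of the two vectors is at least
$\|a_l^{1/2}f\|^2$ by `approx_le_mul`. Thus convergence of the norms forces convergence of the
vectors. -/
theorem norm_sqrtApprox_sub_sq_le {l m : ℝ} (hlm : l ≤ m) (f : H) :
    ‖(a.sqrtApprox m : H →L[ℂ] H) f - (a.sqrtApprox l : H →L[ℂ] H) f‖ ^ 2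
      ≤ ‖(a.sqrtApprox m : H →L[ℂ] H) f‖ ^ 2 - ‖(a.sqrtApprox l : H →L[ℂ] H) f‖ ^ 2 := by
  have h1 := re_inner_le_of_le (a.approx_le_mul hlm) f
  rw [← norm_sqrtApprox_sq, mul_apply_eq_comp, ← inner_sqrtApprox] at h1
  rw [norm_sub_sq (𝕜 := ℂ), ← inner_re_symm]
  change _ - 2 * (inner ℂ ((a.sqrtApprox l : H →L[ℂ] H) f) _).re + _ ≤ _
  linarith

/-! ### The square root -/

theorem mem_sqrtOp_domain_of_bounded {f : H} {C : ℝ}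
    (h : ∀ l, 0 < l → ‖(a.sqrtApprox l : H →L[ℂ] H) f‖ ≤ C) : f ∈ a.sqrtOp.domain := by
  have hm : Monotone fun l => ‖(a.sqrtApprox l : H →L[ℂ] H) f‖ ^ 2 := fun l m hlm =>
    pow_le_pow_left₀ (norm_nonneg _) (a.norm_sqrtApprox_mono f hlm) 2
  have hb : BddAbove (Set.range fun l => ‖(a.sqrtApprox l : H →L[ℂ] H) f‖ ^ 2) := by
    refine ⟨C ^ 2, ?_⟩
    rintro _ ⟨l, rfl⟩
    -- The bound is given only for positive parameters, so monotonicity is used to pass from `l` to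
    -- `max l 1`.
    exact pow_le_pow_left₀ (norm_nonneg _) ((a.norm_sqrtApprox_mono f (le_max_left l 1)).trans
      (h _ (lt_max_of_lt_right one_pos))) 2
  have hc := (tendsto_atTop_ciSup hm hb).cauchySeq
  refine cauchySeq_tendsto_of_complete (Metric.cauchySeq_iff'.2 fun ε hε => ?_)
  obtain ⟨N, hN⟩ := Metric.cauchySeq_iff'.1 hc (ε ^ 2) (by positivity)
  refine ⟨N, fun n hn => ?_⟩
  have h1 := hN n hn
  rw [Real.dist_eq] at h1
  have h2 := (a.norm_sqrtApprox_sub_sq_le hn f).trans_lt ((le_abs_self _).trans_lt h1)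
  rw [dist_eq_norm]
  exact lt_of_pow_lt_pow_left₀ 2 hε.le h2

theorem tendsto_sqrtOp (f : a.sqrtOp.domain) :
    Tendsto (fun l => (a.sqrtApprox l : H →L[ℂ] H) f) atTop (𝓝 (a.sqrtOp f)) := by
  obtain ⟨g, hg⟩ := f.2
  have : a.sqrtOp f = g := hg.limUnder_eq
  rwa [this]

theorem sqrtOp_eq_of_tendsto {f : H} {g : H}
    (h : Tendsto (fun l => (a.sqrtApprox l : H →L[ℂ] H) f) atTop (𝓝 g)) :
    a.sqrtOp ⟨f, g, h⟩ = g := h.limUnder_eq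

theorem norm_sqrtApprox_le (f : a.sqrtOp.domain) (l : ℝ) :
    ‖(a.sqrtApprox l : H →L[ℂ] H) f‖ ≤ ‖a.sqrtOp f‖ :=
  (a.norm_sqrtApprox_mono f).ge_of_tendsto (a.tendsto_sqrtOp f).norm l

/-- For $f\in D(a)$, $a_lf=l(l+a)^{-1}af$, whence $\|a_l^{1/2}f\|^2=\langle
f,a_lf\rangle\le\|f\|\,\|af\|$ uniformly in $l$. -/
theorem op_domain_le (f : a.op.domain) : (f : H) ∈ a.sqrtOp.domain := by
  refine a.mem_sqrtOp_domain_of_bounded (C := √(‖(f : H)‖ * ‖a.op f‖)) fun l hl => ?_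
  refine Real.le_sqrt_of_sq_le ?_
  rw [norm_sqrtApprox_sq]
  have e : (a.approx l : H →L[ℂ] H) f = (l : ℂ) • a.resolvent l hl (a.op f) := by
    have h1 : a.resolvent l hl (a.shift l f) = f := a.resolvent_eq hl rfl
    rw [shift_apply, map_add, map_smul] at h1
    rw [a.approx_of_pos hl]
    change (l : ℂ) • ((f : H) - (l : ℂ) • a.resolvent l hl f) = _
    congr 1
    nth_rw 1 [← h1]
    abel
  refine ((Complex.re_le_norm _).trans (norm_inner_le_norm _ _)).trans ?_
  refine mul_le_mul_of_nonneg_left ?_ (norm_nonneg _)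
  rw [e, norm_smul, Complex.norm_real, Real.norm_of_nonneg hl.le]
  exact a.norm_smul_resolvent_le l hl _

variable {a}

theorem eq_zero_of_approx_eq_zero (ha : Function.Injective a.op) {l : ℝ} (hl : 0 < l) {f : H}
    (h : (a.approx l : H →L[ℂ] H) f = 0) : f = 0 := by
  rw [a.approx_apply l hl, smul_eq_zero] at h
  have h1 := h.resolve_left (by exact_mod_cast hl.ne')
  have h2 := ha (h1.trans a.op.map_zero.symm)
  exact a.eq_zero_of_resolvent_eq_zero hl (congrArg Subtype.val h2)

/-- For $v$ orthogonal to the range and $R=(1+a)^{-1}$, it turns out that $a^{1/2}Rv=0$; then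
$a_1Rv=0$, and injectivity gives $Rv=0$, $v=0$. -/
theorem denseRange_sqrtOp (ha : Function.Injective a.op) : DenseRange a.sqrtOp := by
  change Dense (Set.range a.sqrtOp.toFun)
  rw [← LinearMap.coe_range]
  rw [Submodule.dense_iff_topologicalClosure_eq_top,
    Submodule.topologicalClosure_eq_top_iff, Submodule.eq_bot_iff]
  intro v hv
  have hv' : ∀ ξ : a.sqrtOp.domain, inner ℂ v (a.sqrtOp ξ) = 0 := fun ξ =>
    (Submodule.mem_orthogonal' _ _).1 hv _ ⟨ξ, rfl⟩
  let R := a.resolvent 1 one_pos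
  have hRD : ∀ f, R f ∈ a.sqrtOp.domain := fun f =>
    a.op_domain_le ⟨R f, (a.resolvent_spec 1 one_pos f).1⟩
  have hcR : ∀ l f, (a.sqrtApprox l : H →L[ℂ] H) (R f) = R ((a.sqrtApprox l : H →L[ℂ] H) f) :=
    fun l f => congrArg (fun A : H →L[ℂ] H => A f)
      (a.commute_sqrtApprox_of_commute (a.commute_approx_resolvent l 1 one_pos)).eq
  have hcs : ∀ l m f, (a.sqrtApprox l : H →L[ℂ] H) ((a.sqrtApprox m : H →L[ℂ] H) f)
      = (a.sqrtApprox m : H →L[ℂ] H) ((a.sqrtApprox l : H →L[ℂ] H) f) :=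
    fun l m f => congrArg (fun A : H →L[ℂ] H => A f) (a.commute_sqrtApprox l m).eq
  let u : a.sqrtOp.domain := ⟨R v, hRD v⟩
  have h1 : ∀ l, inner ℂ ((a.sqrtApprox l : H →L[ℂ] H) (R v)) (a.sqrtOp u) = 0 := fun l => by
    -- A test vector for the orthogonality of $v$: as $R$, $a_k^{1/2}$ and $a_l^{1/2}$ are
    -- selfadjoint and commute, $\langle v,a_k^{1/2}\xi\rangle=\langle
    -- a_l^{1/2}Rv,a_k^{1/2}Rv\rangle$, and then $k\to\infty$.
    let ξ : a.sqrtOp.domain := ⟨R (R ((a.sqrtApprox l : H →L[ℂ] H) v)), hRD _⟩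
    have t1 := (tendsto_const_nhds (x := v)).inner (𝕜 := ℂ) (a.tendsto_sqrtOp ξ)
    rw [hv' ξ] at t1
    have t2 := (tendsto_const_nhds (x := (a.sqrtApprox l : H →L[ℂ] H) (R v))).inner (𝕜 := ℂ)
      (a.tendsto_sqrtOp u)
    refine tendsto_nhds_unique t2 (t1.congr fun k => ?_)
    change inner ℂ v ((a.sqrtApprox k : H →L[ℂ] H) (R (R ((a.sqrtApprox l : H →L[ℂ] H) v))))
      = inner ℂ ((a.sqrtApprox l : H →L[ℂ] H) (R v)) ((a.sqrtApprox k : H →L[ℂ] H) (R v))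
    rw [inner_sqrtApprox, a.inner_resolvent 1 one_pos, ← hcR l, ← hcR l, hcs k l, hcR k, hcR l]
  have h2 : inner ℂ (a.sqrtOp u) (a.sqrtOp u) = 0 := by
    have t := (a.tendsto_sqrtOp u).inner (𝕜 := ℂ) (tendsto_const_nhds (x := a.sqrtOp u))
    exact tendsto_nhds_unique t (tendsto_const_nhds.congr fun l => (h1 l).symm)
  have h3 : (a.sqrtApprox 1 : H →L[ℂ] H) (R v) = 0 := by
    have := a.norm_sqrtApprox_le u 1
    rw [inner_self_eq_zero.1 h2, norm_zero] at this
    exact norm_le_zero_iff.1 this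
  have h4 : (a.approx 1 : H →L[ℂ] H) (R v) = 0 := by
    rw [← sqrtApprox_mul_self, mul_apply_eq_comp, h3, map_zero]
  exact a.eq_zero_of_resolvent_eq_zero one_pos (eq_zero_of_approx_eq_zero ha one_pos h4)

/-- $a_1=a(1+a)^{-1}$ is selfadjoint with range inside that of $a$, so it kills every $v$ orthogonal
to the range. -/
theorem denseRange_op (ha : Function.Injective a.op) : DenseRange a.op := by
  change Dense (Set.range a.op.toFun)
  rw [← LinearMap.coe_range]
  rw [Submodule.dense_iff_topologicalClosure_eq_top,
    Submodule.topologicalClosure_eq_top_iff, Submodule.eq_bot_iff]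
  intro v hv
  let R := a.resolvent 1 one_pos
  have h1 : a.op ⟨R v, (a.resolvent_spec 1 one_pos v).1⟩ = 0 := by
    have h2 : ∀ f : H, inner ℂ ((a.approx 1 : H →L[ℂ] H) v) f = 0 := fun f => by
      have h := (Submodule.mem_orthogonal' _ _).1 hv _
        ⟨⟨R f, (a.resolvent_spec 1 one_pos f).1⟩, rfl⟩
      rw [(a.approx_isPositive 1).isSelfAdjoint.isSymmetric.apply_clm v f,
        a.approx_apply 1 one_pos, inner_smul_right]
      exact mul_eq_zero_of_right _ h
    have h3 := inner_self_eq_zero.1 (h2 _)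
    rw [a.approx_apply 1 one_pos] at h3
    simpa using h3
  have h2 := ha (h1.trans a.op.map_zero.symm)
  exact a.eq_zero_of_resolvent_eq_zero one_pos (congrArg Subtype.val h2)

theorem norm_inv_smul_approx_le (a : PosAffiliatedOp M) {l : ℝ} (hl : 0 < l) (f : H) :
    ‖((l⁻¹ : ℝ) : ℂ) • (a.approx l : H →L[ℂ] H) f‖ ≤ 2 * ‖f‖ := by
  have e : ((l⁻¹ : ℝ) : ℂ) • (a.approx l : H →L[ℂ] H) f = f - (l : ℂ) • a.resolvent l hl f := by
    rw [a.approx_of_pos hl]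
    change ((l⁻¹ : ℝ) : ℂ) • ((l : ℂ) • (f - (l : ℂ) • a.resolvent l hl f)) = _
    rw [smul_smul, ← Complex.ofReal_mul, inv_mul_cancel₀ hl.ne', Complex.ofReal_one, one_smul]
  rw [e]
  refine (norm_sub_le _ _).trans ?_
  rw [norm_smul, Complex.norm_real, Real.norm_of_nonneg hl.le]
  linarith [a.norm_smul_resolvent_le l hl f]

/-- Here $l^{-1}a_l=1-l(l+a)^{-1}$. The operators $l(l+a)^{-1}$ are contractions, and on the dense
range of $a$ they tend to $0$, since $(l+a)^{-1}aw=w-l(l+a)^{-1}w$ has norm at most $2\|w\|$. -/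
theorem tendsto_inv_smul_approx (ha : Function.Injective a.op) (f : H) :
    Tendsto (fun l : ℝ => ((l⁻¹ : ℝ) : ℂ) • (a.approx l : H →L[ℂ] H) f) (𝓝[>] 0) (𝓝 f) := by
  rw [Metric.tendsto_nhds]
  intro ε hε
  obtain ⟨w, hw⟩ := (denseRange_op ha).exists_dist_lt f (show 0 < ε / 4 by positivity)
  have hlim : ∀ᶠ l : ℝ in 𝓝[>] 0, l * (2 * ‖(w : H)‖) < ε / 4 := by
    have : Tendsto (fun l : ℝ => l * (2 * ‖(w : H)‖)) (𝓝[>] 0) (𝓝 (0 * (2 * ‖(w : H)‖))) :=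
      (tendsto_nhdsWithin_of_tendsto_nhds tendsto_id).mul_const _
    rw [zero_mul] at this
    exact this.eventually_lt_const (by positivity)
  filter_upwards [hlim, self_mem_nhdsWithin] with l h1 hl
  have hl : 0 < l := hl
  have e : ∀ g, ((l⁻¹ : ℝ) : ℂ) • (a.approx l : H →L[ℂ] H) g - g
      = - ((l : ℂ) • a.resolvent l hl g) := fun g => by
    rw [a.approx_of_pos hl]
    change ((l⁻¹ : ℝ) : ℂ) • ((l : ℂ) • (g - (l : ℂ) • a.resolvent l hl g)) - g = _
    rw [smul_smul, ← Complex.ofReal_mul, inv_mul_cancel₀ hl.ne', Complex.ofReal_one, one_smul]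
    abel
  rw [dist_eq_norm, e, norm_neg, norm_smul, Complex.norm_real, Real.norm_of_nonneg hl.le]
  have h2 : a.resolvent l hl (a.op w) = w - (l : ℂ) • a.resolvent l hl w := by
    have h := a.resolvent_eq hl (w := w) rfl
    rw [shift_apply, map_add, map_smul] at h
    exact eq_sub_of_add_eq h
  have h3 : ‖a.resolvent l hl (a.op w)‖ ≤ 2 * ‖(w : H)‖ := by
    rw [h2]
    refine (norm_sub_le _ _).trans ?_
    rw [norm_smul, Complex.norm_real, Real.norm_of_nonneg hl.le]
    linarith [a.norm_smul_resolvent_le l hl (w : H)]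
  have h4 : a.resolvent l hl f = a.resolvent l hl (f - a.op w) + a.resolvent l hl (a.op w) := by
    rw [← map_add, sub_add_cancel]
  have h5 := a.norm_smul_resolvent_le l hl (f - a.op w)
  rw [dist_eq_norm] at hw
  calc l * ‖a.resolvent l hl f‖
      ≤ l * (‖a.resolvent l hl (f - a.op w)‖ + ‖a.resolvent l hl (a.op w)‖) := by
        rw [h4]; exact mul_le_mul_of_nonneg_left (norm_add_le _ _) hl.le
    _ ≤ ‖f - a.op w‖ + l * (2 * ‖(w : H)‖) := by
        rw [mul_add]; exact add_le_add h5 (mul_le_mul_of_nonneg_left h3 hl.le)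
    _ < ε := by linarith

end PosAffiliatedOp

end AffiliatedL1

end

/-! ### Functionals finite at `a` as sequences in the domain of $a^{1/2}$ -/

noncomputable section

namespace AffiliatedL1

variable {H : Type*} [NormedAddCommGroup H] [InnerProductSpace ℂ H] [CompleteSpace H]
  {M : VonNeumannAlgebra H}

/-- The functional `φ` is the sum of the vector functionals given by the sequence `ζ`. -/
def IsRepr (φ : Functional M) (ζ : SqSum H) : Prop :=
  ∀ y : M.toStarSubalgebra, φ y = inner ℂ ζ (diag (y : H →L[ℂ] H) ζ)

theorem IsRepr.hasSum_conj {φ : Functional M} {ζ : SqSum H} (h : IsRepr φ ζ)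
    {t : M.toStarSubalgebra} (ht : star (t : H →L[ℂ] H) = t) (y : M.toStarSubalgebra) :
    HasSum (fun n => inner ℂ ((t : H →L[ℂ] H) (ζ n))
      ((y : H →L[ℂ] H) ((t : H →L[ℂ] H) (ζ n)))) (φ (t * y * t)) := by
  have e : φ (t * y * t) = inner ℂ (diag (t : H →L[ℂ] H) ζ)
      (diag (y : H →L[ℂ] H) (diag (t : H →L[ℂ] H) ζ)) := by
    rw [h]
    change inner ℂ ζ (diag ((t : H →L[ℂ] H) * (y : H →L[ℂ] H) * (t : H →L[ℂ] H)) ζ) = _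
    rw [diag_mul, diag_mul, inner_diag_right, ht]
  rw [e]
  simpa only [diag_apply] using lp.hasSum_inner (𝕜 := ℂ) (diag (t : H →L[ℂ] H) ζ)
    (diag (y : H →L[ℂ] H) (diag (t : H →L[ℂ] H) ζ))

theorem IsRepr.tendsto_conj {φ : Functional M} {ζ : SqSum H} (h : IsRepr φ ζ) {F : Filter ℝ}
    {t : ℝ → M.toStarSubalgebra} (ht : ∀ l, star (t l : H →L[ℂ] H) = t l) {g : ℕ → H}
    (hg : ∀ n, Tendsto (fun l => (t l : H →L[ℂ] H) (ζ n)) F (𝓝 (g n))) {b : ℕ → ℝ}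
    (hb : Summable fun n => b n ^ 2) (hbound : ∀ᶠ l in F, ∀ n, ‖(t l : H →L[ℂ] H) (ζ n)‖ ≤ b n)
    (y : M.toStarSubalgebra) :
    Tendsto (fun l => φ (t l * y * t l)) F (𝓝 (∑' n, inner ℂ (g n) ((y : H →L[ℂ] H) (g n)))) := by
  have e : (fun l => φ (t l * y * t l)) = fun l => ∑' n, inner ℂ ((t l : H →L[ℂ] H) (ζ n))
      ((y : H →L[ℂ] H) ((t l : H →L[ℂ] H) (ζ n))) :=
    funext fun l => (h.hasSum_conj (ht l) y).tsum_eq.symm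
  rw [e]
  refine tendsto_tsum_of_dominated_convergence (bound := fun n => ‖(y : H →L[ℂ] H)‖ * b n ^ 2)
    (hb.mul_left _) (fun n => ?_) ?_
  · exact (hg n).inner (((y : H →L[ℂ] H).continuous.tendsto _).comp (hg n))
  · filter_upwards [hbound] with l hl n
    exact (norm_inner_apply_le _ _).trans
      (mul_le_mul_of_nonneg_left (pow_le_pow_left₀ (norm_nonneg _) (hl n) 2) (norm_nonneg _))

/-- The vector functional `y ↦ ⟨y ξ, ξ⟩`. -/
def vecFunctional (M : VonNeumannAlgebra H) (ξ : H) : Functional M where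
  toFun y := inner ℂ ξ ((y : H →L[ℂ] H) ξ)
  map_add' _ _ := inner_add_right _ _ _
  map_smul' _ _ := inner_smul_right _ _ _

theorem vecFunctional_apply (ξ : H) (y : M.toStarSubalgebra) :
    vecFunctional M ξ y = inner ℂ ξ ((y : H →L[ℂ] H) ξ) := rfl

theorem isPos_vecFunctional (ξ : H) : IsPos (vecFunctional M ξ) := fun _ hy =>
  hy.inner_nonneg_right ξ

theorem isNormal_vecFunctional (ξ : H) : IsNormal (vecFunctional M ξ) := by
  let e : SqSum H := lp.single 2 0 ξ
  have h : (vecFunctional M ξ : M.toStarSubalgebra → ℂ)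
      = fun x : M.toStarSubalgebra => ∑' n, inner ℂ (e n) ((x : H →L[ℂ] H) (e n)) := by
    funext y
    rw [tsum_eq_single 0]
    · simp [e, vecFunctional_apply]
    · intro n hn
      simp [e, lp.single_apply, hn]
  change Continuous[ultraweakTopology M, inferInstance] (vecFunctional M ξ : M.toStarSubalgebra → ℂ)
  rw [h]
  exact continuous_iInf_dom (i := e) (continuous_iInf_dom (i := e) continuous_induced_dom)

theorem IsNormal.sub {φ ψ : Functional M} (hφ : IsNormal φ) (hψ : IsNormal ψ) :
    IsNormal (φ - ψ) := by
  let := ultraweakTopology M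
  exact Continuous.sub (X := M.toStarSubalgebra) hφ hψ

namespace PosAffiliatedOp

variable (a : PosAffiliatedOp M)

theorem re_approx_le_eval {φ : Functional M} (h : φ ∈ a.Dpos) (l : ℝ) :
    (φ (a.approx l)).re ≤ (a.eval φ).toReal := by
  rcases le_or_gt l 0 with hl | hl
  · rw [a.approx_of_nonpos hl]; simp
  · refine (ENNReal.ofReal_le_iff_le_toReal h.2.2.ne).1 ?_
    exact le_iSup₂ (f := fun (l : ℝ) (_ : 0 < l) => ENNReal.ofReal (φ (a.approx l)).re) l hl

theorem sqrtApprox_mul_one_mul (l : ℝ) : a.sqrtApprox l * 1 * a.sqrtApprox l = a.approx l := by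
  rw [mul_one]; exact Subtype.ext (a.sqrtApprox_mul_self l)

theorem hasSum_approx {φ : Functional M} {ζ : SqSum H} (h : IsRepr φ ζ) (l : ℝ) :
    HasSum (fun n => ‖(a.sqrtApprox l : H →L[ℂ] H) (ζ n)‖ ^ 2) (φ (a.approx l)).re := by
  have h1 := h.hasSum_conj (a.star_sqrtApprox l) 1
  rw [a.sqrtApprox_mul_one_mul] at h1
  have h2 := Complex.hasSum_re h1
  refine h2.congr_fun ?_
  intro n
  change _ = (inner ℂ ((a.sqrtApprox l : H →L[ℂ] H) (ζ n))
    ((a.sqrtApprox l : H →L[ℂ] H) (ζ n))).re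
  rw [← inner_approx, norm_sqrtApprox_sq]

theorem norm_conj_le_eval {φ : Functional M} (h : φ ∈ a.Dpos) (x : M.toStarSubalgebra) (l : ℝ) :
    ‖φ (a.sqrtApprox l * x * a.sqrtApprox l)‖ ≤ ‖(x : H →L[ℂ] H)‖ * (a.eval φ).toReal := by
  obtain ⟨ζ, hζ⟩ := exists_repr h.1 h.2.1
  have h1 := IsRepr.hasSum_conj hζ (a.star_sqrtApprox l) x
  have h2 := (a.hasSum_approx hζ l).mul_left ‖(x : H →L[ℂ] H)‖
  rw [← h1.tsum_eq]
  exact (tsum_of_norm_bounded h2 fun n => norm_inner_apply_le _ _).trans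
    (mul_le_mul_of_nonneg_left (a.re_approx_le_eval h l) (norm_nonneg _))

theorem repr_mem_domain {φ : Functional M} (h : φ ∈ a.Dpos) {ζ : SqSum H} (hζ : IsRepr φ ζ)
    (n : ℕ) : ζ n ∈ a.sqrtOp.domain := by
  refine a.mem_sqrtOp_domain_of_bounded (C := √(a.eval φ).toReal) fun l hl => ?_
  refine Real.le_sqrt_of_sq_le ?_
  exact (le_hasSum (a.hasSum_approx hζ l) n fun _ _ => sq_nonneg _).trans (a.re_approx_le_eval h l)

/-- Positive normal functionals with finite value at `a` are given by sequences in the domain of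
`a^{1/2}`. -/
theorem exists_repr_domain {φ : Functional M} (h : φ ∈ a.Dpos) :
    ∃ ζ : SqSum H, ∃ ξ : ℕ → a.sqrtOp.domain, IsRepr φ ζ ∧ (∀ n, (ξ n : H) = ζ n) ∧
      Summable fun n => ‖a.sqrtOp (ξ n)‖ ^ 2 := by
  obtain ⟨ζ, hζ⟩ := exists_repr h.1 h.2.1
  refine ⟨ζ, fun n => ⟨ζ n, a.repr_mem_domain h hζ n⟩, hζ, fun n => rfl, ?_⟩
  refine summable_of_sum_le (c := (a.eval φ).toReal) (fun _ => sq_nonneg _) fun s => ?_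
  have ht : Tendsto (fun l => ∑ n ∈ s, ‖(a.sqrtApprox l : H →L[ℂ] H) (ζ n)‖ ^ 2) atTop
      (𝓝 (∑ n ∈ s, ‖a.sqrtOp ⟨ζ n, a.repr_mem_domain h hζ n⟩‖ ^ 2)) :=
    tendsto_finsetSum _ fun n _ => (a.tendsto_sqrtOp _).norm.pow 2
  refine le_of_tendsto ht (Eventually.of_forall fun l => ?_)
  exact (sum_le_hasSum s (fun _ _ => sq_nonneg _) (a.hasSum_approx hζ l)).trans
    (a.re_approx_le_eval h l)

theorem eval_le_tsum {φ : Functional M} {ζ : SqSum H} (hζ : IsRepr φ ζ)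
    {ξ : ℕ → a.sqrtOp.domain} (hξ : ∀ n, (ξ n : H) = ζ n)
    (hs : Summable fun n => ‖a.sqrtOp (ξ n)‖ ^ 2) :
    a.eval φ ≤ ENNReal.ofReal (∑' n, ‖a.sqrtOp (ξ n)‖ ^ 2) := by
  refine iSup₂_le fun l hl => ENNReal.ofReal_le_ofReal ?_
  rw [← (a.hasSum_approx hζ l).tsum_eq]
  refine (a.hasSum_approx hζ l).summable.tsum_le_tsum (fun n => ?_) hs
  rw [← hξ]
  exact pow_le_pow_left₀ (norm_nonneg _) (a.norm_sqrtApprox_le _ l) 2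

theorem tendsto_conj_repr {φ : Functional M} {ζ : SqSum H} (hζ : IsRepr φ ζ)
    {ξ : ℕ → a.sqrtOp.domain} (hξ : ∀ n, (ξ n : H) = ζ n)
    (hs : Summable fun n => ‖a.sqrtOp (ξ n)‖ ^ 2) (x : M.toStarSubalgebra) :
    Tendsto (fun l => φ (a.sqrtApprox l * x * a.sqrtApprox l)) atTop
      (𝓝 (∑' n, a.form x (ξ n) (ξ n))) := by
  refine hζ.tendsto_conj (fun l => a.star_sqrtApprox l) (fun n => ?_) hs
    (Eventually.of_forall fun l n => ?_) x
  · rw [← hξ]; exact a.tendsto_sqrtOp _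
  · rw [← hξ]; exact a.norm_sqrtApprox_le _ l

theorem sandwich_repr {φ : Functional M} {ζ : SqSum H} (hζ : IsRepr φ ζ)
    {ξ : ℕ → a.sqrtOp.domain} (hξ : ∀ n, (ξ n : H) = ζ n)
    (hs : Summable fun n => ‖a.sqrtOp (ξ n)‖ ^ 2) (x : M.toStarSubalgebra) :
    a.sandwich φ x = ∑' n, a.form x (ξ n) (ξ n) :=
  (a.tendsto_conj_repr hζ hξ hs x).limUnder_eq

/-! ### The pairing -/

theorem sandwich_nonneg {φ : Functional M} (h : φ ∈ a.Dpos) {x : M.toStarSubalgebra}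
    (hx : ∀ f, 0 ≤ a.form x f f) : 0 ≤ a.sandwich φ x := by
  obtain ⟨ζ, ξ, hζ, hξ, hs⟩ := a.exists_repr_domain h
  rw [a.sandwich_repr hζ hξ hs]
  exact tsum_nonneg fun n => hx _

/-- Guarantees that the `limUnder` in `sandwich` is a genuine limit on $\mathfrak D_a^h$; linearity
and the norm bound follow from it. -/
theorem tendsto_sandwich (φ : a.Dh) (x : M.toStarSubalgebra) :
    Tendsto (fun l => (φ : Functional M) (a.sqrtApprox l * x * a.sqrtApprox l)) atTop
      (𝓝 (a.sandwich φ x)) := by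
  obtain ⟨φ₁, h₁, φ₂, h₂, h⟩ := φ.2
  obtain ⟨ζ₁, ξ₁, r₁, e₁, s₁⟩ := a.exists_repr_domain h₁
  obtain ⟨ζ₂, ξ₂, r₂, e₂, s₂⟩ := a.exists_repr_domain h₂
  have t := (a.tendsto_conj_repr r₁ e₁ s₁ x).sub (a.tendsto_conj_repr r₂ e₂ s₂ x)
  have t' : Tendsto (fun l => (φ : Functional M) (a.sqrtApprox l * x * a.sqrtApprox l)) atTop
      (𝓝 (∑' n, a.form x (ξ₁ n) (ξ₁ n) - ∑' n, a.form x (ξ₂ n) (ξ₂ n))) := by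
    rw [h]; exact t
  have e : a.sandwich φ x = _ := t'.limUnder_eq
  rwa [e]

theorem norm_conj_le (φ : a.Dh) (x : M.toStarSubalgebra) (l : ℝ) :
    ‖(φ : Functional M) (a.sqrtApprox l * x * a.sqrtApprox l)‖ ≤ ‖(x : H →L[ℂ] H)‖ * ‖φ‖ := by
  rw [norm_def, ← smul_eq_mul ‖(x : H →L[ℂ] H)‖, ← Real.sInf_smul_of_nonneg (norm_nonneg _)]
  refine le_csInf (a.normSet_nonempty φ).smul_set ?_
  rintro _ ⟨_, ⟨φ₁, h₁, φ₂, h₂, h, rfl⟩, rfl⟩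
  change _ ≤ _ * _
  rw [h, LinearMap.sub_apply, mul_add]
  exact (norm_sub_le _ _).trans
    (add_le_add (a.norm_conj_le_eval h₁ x l) (a.norm_conj_le_eval h₂ x l))

theorem norm_sandwich_le (φ : a.Dh) (x : M.toStarSubalgebra) :
    ‖a.sandwich φ x‖ ≤ ‖(x : H →L[ℂ] H)‖ * ‖φ‖ :=
  le_of_tendsto (a.tendsto_sandwich φ x).norm (Eventually.of_forall (a.norm_conj_le φ x))

/-- The pairing of `𝔇_a^h` with `x`, as a continuous real linear map. -/
def sandwichCLM (x : M.toStarSubalgebra) : a.Dh →L[ℝ] ℂ :=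
  LinearMap.mkContinuous
    { toFun := fun φ => a.sandwich φ x
      map_add' := fun φ ψ => tendsto_nhds_unique (a.tendsto_sandwich (φ + ψ) x)
        ((a.tendsto_sandwich φ x).add (a.tendsto_sandwich ψ x))
      map_smul' := fun c φ => tendsto_nhds_unique (a.tendsto_sandwich (c • φ) x)
        ((a.tendsto_sandwich φ x).const_smul c) }
    ‖(x : H →L[ℂ] H)‖ fun φ => a.norm_sandwich_le φ x

theorem pairH_coe (φ : a.Dh) (x : M.toStarSubalgebra) :
    a.pairH (φ : a.L1h) x = a.sandwich φ x :=
  UniformSpace.Completion.extension_coe (a.sandwichCLM x).uniformContinuous φ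

theorem continuous_pairH (x : M.toStarSubalgebra) : Continuous fun χ => a.pairH χ x :=
  UniformSpace.Completion.continuous_extension

theorem norm_pairH_le (χ : a.L1h) (x : M.toStarSubalgebra) :
    ‖a.pairH χ x‖ ≤ ‖(x : H →L[ℂ] H)‖ * ‖χ‖ := by
  refine UniformSpace.Completion.induction_on χ ?_ fun φ => ?_
  · exact isClosed_le (a.continuous_pairH x).norm (continuous_const.mul continuous_norm)
  · rw [pairH_coe, UniformSpace.Completion.norm_coe]; exact a.norm_sandwich_le φ x

theorem pairH_zero (x : M.toStarSubalgebra) : a.pairH 0 x = 0 := by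
  have h := a.norm_pairH_le 0 x
  rw [norm_zero, mul_zero] at h
  exact norm_le_zero_iff.1 h

theorem im_pairH_eq_zero (χ : a.L1h) {x : M.toStarSubalgebra} (hx : ∀ f, 0 ≤ a.form x f f) :
    (a.pairH χ x).im = 0 := by
  refine UniformSpace.Completion.induction_on χ ?_ fun φ => ?_
  · exact isClosed_eq (Complex.continuous_im.comp (a.continuous_pairH x)) continuous_const
  · obtain ⟨φ₁, h₁, φ₂, h₂, h⟩ := φ.2
    have e : φ = ⟨φ₁, a.Dpos_subset_Dh h₁⟩ - ⟨φ₂, a.Dpos_subset_Dh h₂⟩ := Subtype.ext h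
    have e2 : a.sandwich φ x = a.sandwich φ₁ x - a.sandwich φ₂ x := by
      rw [e]; exact map_sub (a.sandwichCLM x) _ _
    rw [pairH_coe, e2, Complex.sub_im, ← (Complex.le_def.1 (a.sandwich_nonneg h₁ hx)).2,
      ← (Complex.le_def.1 (a.sandwich_nonneg h₂ hx)).2, sub_self]

/-- Only this inequality between the two norms is needed: approximation in the completion then gives
approximation in the norm of $L_1(a)$. -/
theorem normL1_le (χ : a.L1h) : a.normL1 (χ, 0) ≤ ‖χ‖ := by
  refine Real.iSup_le (fun x => ?_) (norm_nonneg _)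
  rw [pair, pairH_zero, mul_zero, add_zero]
  exact (a.norm_pairH_le χ x).trans (mul_le_of_le_one_left (norm_nonneg _) x.2)

/-- The decomposition $\varphi=\varphi-0$ bounds the norm by $\varphi(a)$, and pairing with $1$
gives $\sum_n\|a^{1/2}\xi_n\|^2\ge\varphi(a)$. In the closed cone this forces an element with zero
pairing against $1$ to vanish. -/
theorem norm_le_sandwich_one {φ : a.Dh} (h : (φ : Functional M) ∈ a.Dpos) :
    ‖φ‖ ≤ (a.sandwich φ 1).re := by
  obtain ⟨ζ, ξ, hζ, hξ, hs⟩ := a.exists_repr_domain h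
  have h1 : a.sandwich φ 1 = ((∑' n, ‖a.sqrtOp (ξ n)‖ ^ 2 : ℝ) : ℂ) := by
    rw [a.sandwich_repr hζ hξ hs, Complex.ofReal_tsum]
    refine tsum_congr fun n => ?_
    rw [Complex.ofReal_pow]
    exact inner_self_eq_norm_sq_to_K (𝕜 := ℂ) _
  have h2 := ENNReal.toReal_mono ENNReal.ofReal_ne_top (a.eval_le_tsum hζ hξ hs)
  rw [ENNReal.toReal_ofReal (tsum_nonneg fun _ => sq_nonneg _)] at h2
  rw [h1, Complex.ofReal_re]
  refine le_trans (csInf_le (a.normSet_bddBelow _) ?_) h2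
  refine ⟨φ, h, 0, a.zero_mem_Dpos, (sub_zero _).symm, ?_⟩
  simp [eval]

theorem norm_le_eval {φ : a.Dh} (h : (φ : Functional M) ∈ a.Dpos) :
    ‖φ‖ ≤ (a.eval φ).toReal := by
  refine csInf_le (a.normSet_bddBelow _) ⟨φ, h, 0, a.zero_mem_Dpos, (sub_zero _).symm, ?_⟩
  simp [eval]

/-! ### Injectivity -/

variable {a}

theorem tendsto_conj_inv_smul_approx (ha : Function.Injective a.op) {φ : Functional M}
    (h : φ ∈ a.Dpos) (y : M.toStarSubalgebra) :
    Tendsto (fun l : ℝ => φ ((((l⁻¹ : ℝ) : ℂ) • a.approx l) * y * (((l⁻¹ : ℝ) : ℂ) • a.approx l)))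
      (𝓝[>] 0) (𝓝 (φ y)) := by
  obtain ⟨ζ, hζ⟩ := exists_repr h.1 h.2.1
  have e : φ y = ∑' n, inner ℂ (ζ n) ((y : H →L[ℂ] H) (ζ n)) := by rw [hζ, inner_diag]
  rw [e]
  refine IsRepr.tendsto_conj hζ (t := fun l : ℝ => ((l⁻¹ : ℝ) : ℂ) • a.approx l) (fun l => ?_)
    (fun n => tendsto_inv_smul_approx ha (ζ n)) (b := fun n => 2 * ‖ζ n‖) ?_ ?_ y
  · change star (((l⁻¹ : ℝ) : ℂ) • (a.approx l : H →L[ℂ] H)) = _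
    rw [star_smul, (a.approx_isPositive l).isSelfAdjoint.star_eq, RCLike.star_def,
      Complex.conj_ofReal]
    rfl
  · simp only [mul_pow]
    exact (summable_norm_sq ζ).mul_left _
  · filter_upwards [self_mem_nhdsWithin] with l hl n
    exact norm_inv_smul_approx_le a hl (ζ n)

theorem eq_zero_of_norm_eq_zero (ha : Function.Injective a.op) {φ : a.Dh} (h : ‖φ‖ = 0) :
    φ = 0 := by
  have h1 : ∀ l x, (φ : Functional M) (a.sqrtApprox l * x * a.sqrtApprox l) = 0 := fun l x => by
    have := a.norm_conj_le φ x l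
    rw [h, mul_zero] at this
    exact norm_le_zero_iff.1 this
  obtain ⟨φ₁, h₁, φ₂, h₂, e⟩ := φ.2
  refine Subtype.ext (LinearMap.ext fun y => ?_)
  have t := (tendsto_conj_inv_smul_approx ha h₁ y).sub (tendsto_conj_inv_smul_approx ha h₂ y)
  simp only [← LinearMap.sub_apply, ← e] at t
  refine tendsto_nhds_unique t (tendsto_const_nhds.congr fun l => ?_)
  -- The factor $a_l=a_l^{1/2}a_l^{1/2}$ is split on both sides, so the argument has the form
  -- $a_l^{1/2}xa_l^{1/2}$ on which $\varphi$ vanishes.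
  have e2 : (((l⁻¹ : ℝ) : ℂ) • a.approx l) * y * (((l⁻¹ : ℝ) : ℂ) • a.approx l)
      = ((l⁻¹ : ℝ) : ℂ) • ((l⁻¹ : ℝ) : ℂ) • (a.sqrtApprox l *
        (a.sqrtApprox l * y * a.sqrtApprox l) * a.sqrtApprox l) := by
    rw [smul_mul_assoc, smul_mul_assoc, mul_smul_comm, ← a.sqrtApprox_mul_one_mul l, mul_one]
    simp only [mul_assoc]
  rw [e2, map_smul, map_smul, h1, smul_zero, smul_zero]
  rfl

theorem embed_injective (ha : Function.Injective a.op) : Function.Injective a.embed := by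
  intro φ ψ h
  have h1 : (φ : a.L1h) = ψ := congrArg Prod.fst h
  have h2 : ‖φ - ψ‖ = 0 := by
    rw [← UniformSpace.Completion.norm_coe, UniformSpace.Completion.coe_sub, h1, sub_self,
      norm_zero]
  exact sub_eq_zero.1 (eq_zero_of_norm_eq_zero ha h2)

end PosAffiliatedOp

end AffiliatedL1

end

/-! ### Real functionals on $\mathfrak D_a^h$ as elements of `M` -/

noncomputable section

namespace AffiliatedL1

variable {H : Type*} [NormedAddCommGroup H] [InnerProductSpace ℂ H] [CompleteSpace H]
  {M : VonNeumannAlgebra H}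

/-- The hermitian part `y ↦ (⟨y ξ, η⟩ + ⟨y η, ξ⟩) / 2` of a vector functional. -/
def polarFunctional (M : VonNeumannAlgebra H) (η ξ : H) : Functional M where
  toFun y := (inner ℂ η ((y : H →L[ℂ] H) ξ) + inner ℂ ξ ((y : H →L[ℂ] H) η)) / 2
  map_add' x y := by
    change (inner ℂ η ((x : H →L[ℂ] H) ξ + (y : H →L[ℂ] H) ξ)
      + inner ℂ ξ ((x : H →L[ℂ] H) η + (y : H →L[ℂ] H) η)) / 2 = _
    rw [inner_add_right, inner_add_right]; ring
  map_smul' c y := by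
    change (inner ℂ η (c • (y : H →L[ℂ] H) ξ) + inner ℂ ξ (c • (y : H →L[ℂ] H) η)) / 2 = _
    rw [inner_smul_right, inner_smul_right, RingHom.id_apply, smul_eq_mul]; ring

theorem polarFunctional_apply (η ξ : H) (y : M.toStarSubalgebra) :
    polarFunctional M η ξ y
      = (inner ℂ η ((y : H →L[ℂ] H) ξ) + inner ℂ ξ ((y : H →L[ℂ] H) η)) / 2 := rfl

theorem polarFunctional_self (ξ : H) : polarFunctional M ξ ξ = vecFunctional M ξ := by
  ext y; rw [polarFunctional_apply, vecFunctional_apply]; ring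

theorem polarFunctional_eq_sub (η ξ : H) : polarFunctional M η ξ
    = vecFunctional M ((1 / 2 : ℂ) • (η + ξ)) - vecFunctional M ((1 / 2 : ℂ) • (η - ξ)) := by
  ext y
  have e : (starRingEnd ℂ) (1 / 2 : ℂ) = 1 / 2 := by
    rw [map_div₀, map_one, map_ofNat]
  simp only [LinearMap.sub_apply, polarFunctional_apply, vecFunctional_apply, map_smul, map_add,
    map_sub, inner_smul_left, inner_smul_right, inner_add_left, inner_add_right, inner_sub_left,
    inner_sub_right, e]
  ring

namespace PosAffiliatedOp

variable (a : PosAffiliatedOp M)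

theorem eval_vecFunctional_le (ξ : a.sqrtOp.domain) :
    a.eval (vecFunctional M (ξ : H)) ≤ ENNReal.ofReal (‖a.sqrtOp ξ‖ ^ 2) := by
  refine iSup₂_le fun l hl => ENNReal.ofReal_le_ofReal ?_
  rw [vecFunctional_apply, ← norm_sqrtApprox_sq]
  exact pow_le_pow_left₀ (norm_nonneg _) (a.norm_sqrtApprox_le ξ l) 2

theorem vecFunctional_mem_Dpos (ξ : a.sqrtOp.domain) : vecFunctional M (ξ : H) ∈ a.Dpos :=
  ⟨isPos_vecFunctional _, isNormal_vecFunctional _,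
    (a.eval_vecFunctional_le ξ).trans_lt ENNReal.ofReal_lt_top⟩

theorem polarFunctional_mem_Dh (η ξ : a.sqrtOp.domain) :
    polarFunctional M (η : H) (ξ : H) ∈ a.Dh :=
  ⟨_, a.vecFunctional_mem_Dpos ((1 / 2 : ℂ) • (η + ξ)), _,
    a.vecFunctional_mem_Dpos ((1 / 2 : ℂ) • (η - ξ)), polarFunctional_eq_sub _ _⟩

/-- The vector functional of an element of the domain of `a^{1/2}`, in `𝔇_a^h`. -/
def vecDh (ξ : a.sqrtOp.domain) : a.Dh := ⟨_, a.Dpos_subset_Dh (a.vecFunctional_mem_Dpos ξ)⟩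

/-- The hermitian part of a vector functional, in `𝔇_a^h`. -/
def polarDh (η ξ : a.sqrtOp.domain) : a.Dh := ⟨_, a.polarFunctional_mem_Dh η ξ⟩

theorem sandwich_vecDh (ξ : a.sqrtOp.domain) (x : M.toStarSubalgebra) :
    a.sandwich (a.vecDh ξ : Functional M) x = a.form x ξ ξ := by
  refine Tendsto.limUnder_eq ?_
  have t := (a.tendsto_sqrtOp ξ).inner (𝕜 := ℂ)
    (((x : H →L[ℂ] H).continuous.tendsto _).comp (a.tendsto_sqrtOp ξ))
  refine t.congr fun l => ?_
  rw [inner_sqrtApprox]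
  rfl

theorem norm_vecDh_le (ξ : a.sqrtOp.domain) : ‖a.vecDh ξ‖ ≤ ‖a.sqrtOp ξ‖ ^ 2 := by
  refine (a.norm_le_eval (a.vecFunctional_mem_Dpos ξ)).trans ?_
  have h := ENNReal.toReal_mono ENNReal.ofReal_ne_top (a.eval_vecFunctional_le ξ)
  rwa [ENNReal.toReal_ofReal (sq_nonneg _)] at h

theorem polarDh_self (ξ : a.sqrtOp.domain) : a.polarDh ξ ξ = a.vecDh ξ :=
  Subtype.ext (polarFunctional_self _)

theorem polarDh_symm (η ξ : a.sqrtOp.domain) : a.polarDh η ξ = a.polarDh ξ η := by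
  refine Subtype.ext (LinearMap.ext fun y => ?_)
  change polarFunctional M _ _ y = polarFunctional M _ _ y
  rw [polarFunctional_apply, polarFunctional_apply, add_comm]

theorem polarDh_add_left (η η' ξ : a.sqrtOp.domain) :
    a.polarDh (η + η') ξ = a.polarDh η ξ + a.polarDh η' ξ := by
  refine Subtype.ext (LinearMap.ext fun y => ?_)
  change polarFunctional M ((η : H) + η') ξ y
    = polarFunctional M (η : H) ξ y + polarFunctional M (η' : H) ξ y
  simp only [polarFunctional_apply, map_add, inner_add_left, inner_add_right]
  ring

/-- $\mathfrak D_a^h$ is only a real space, so the imaginary part of the scalar is recorded by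
rotating the other vector by $i$. This is what makes `complexForm` sesquilinear. -/
theorem polarDh_smul_left (c : ℂ) (η ξ : a.sqrtOp.domain) :
    a.polarDh (c • η) ξ = c.re • a.polarDh η ξ - c.im • a.polarDh η (Complex.I • ξ) := by
  refine Subtype.ext (LinearMap.ext fun y => ?_)
  change polarFunctional M (c • (η : H)) ξ y
    = c.re • polarFunctional M (η : H) ξ y
      - c.im • polarFunctional M (η : H) (Complex.I • (ξ : H)) y
  simp only [polarFunctional_apply, map_smul, inner_smul_left, inner_smul_right,
    Complex.real_smul, Complex.conj_I]
  nth_rw 1 2 [← Complex.re_add_im c]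
  simp only [map_add, map_mul, Complex.conj_ofReal, Complex.conj_I]
  ring

theorem polarDh_smul_I_self (ξ : a.sqrtOp.domain) : a.polarDh ξ (Complex.I • ξ) = 0 := by
  refine Subtype.ext (LinearMap.ext fun y => ?_)
  change polarFunctional M (ξ : H) (Complex.I • (ξ : H)) y = 0
  simp only [polarFunctional_apply, map_smul, inner_smul_left, inner_smul_right, Complex.conj_I]
  ring

theorem polarDh_smul_I_smul_I (η ξ : a.sqrtOp.domain) :
    a.polarDh η (Complex.I • Complex.I • ξ) = - a.polarDh η ξ := by
  rw [smul_smul, Complex.I_mul_I, neg_one_smul]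
  refine Subtype.ext (LinearMap.ext fun y => ?_)
  change polarFunctional M (η : H) (-(ξ : H)) y = - polarFunctional M (η : H) (ξ : H) y
  simp only [polarFunctional_apply, map_neg, inner_neg_left, inner_neg_right]
  ring

theorem polarDh_smul_I_symm (η ξ : a.sqrtOp.domain) :
    a.polarDh ξ (Complex.I • η) = - a.polarDh η (Complex.I • ξ) := by
  rw [polarDh_symm, polarDh_smul_left, Complex.I_re, Complex.I_im, zero_smul, one_smul, zero_sub]

/-- The form on the domain of `a^{1/2}` given by a real functional on `𝔇_a^h`. -/
def complexForm (f : a.Dh →L[ℝ] ℝ) (η ξ : a.sqrtOp.domain) : ℂ :=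
  (f (a.polarDh η ξ) : ℂ) - Complex.I * (f (a.polarDh η (Complex.I • ξ)) : ℂ)

theorem complexForm_self (f : a.Dh →L[ℝ] ℝ) (ξ : a.sqrtOp.domain) :
    a.complexForm f ξ ξ = f (a.vecDh ξ) := by
  rw [complexForm, polarDh_smul_I_self, polarDh_self, f.map_zero, Complex.ofReal_zero, mul_zero,
    sub_zero]

theorem conj_complexForm (f : a.Dh →L[ℝ] ℝ) (η ξ : a.sqrtOp.domain) :
    (starRingEnd ℂ) (a.complexForm f ξ η) = a.complexForm f η ξ := by
  rw [complexForm, complexForm, map_sub, map_mul, Complex.conj_I, Complex.conj_ofReal,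
    Complex.conj_ofReal, a.polarDh_symm ξ η, a.polarDh_smul_I_symm, f.map_neg, Complex.ofReal_neg]
  ring

theorem complexForm_add_left (f : a.Dh →L[ℝ] ℝ) (η η' ξ : a.sqrtOp.domain) :
    a.complexForm f (η + η') ξ = a.complexForm f η ξ + a.complexForm f η' ξ := by
  rw [complexForm, complexForm, complexForm, polarDh_add_left, polarDh_add_left, f.map_add,
    f.map_add, Complex.ofReal_add, Complex.ofReal_add]
  ring

theorem complexForm_smul_left (f : a.Dh →L[ℝ] ℝ) (c : ℂ) (η ξ : a.sqrtOp.domain) :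
    a.complexForm f (c • η) ξ = (starRingEnd ℂ) c * a.complexForm f η ξ := by
  have alg : ∀ p q : ℝ, ((c.re * p - c.im * q : ℝ) : ℂ)
      - Complex.I * ((c.re * q + c.im * p : ℝ) : ℂ)
      = (starRingEnd ℂ) c * ((p : ℂ) - Complex.I * q) := fun p q => by
    have e : (starRingEnd ℂ) c = c.re - Complex.I * c.im := by
      nth_rw 1 [← Complex.re_add_im c]
      rw [map_add, map_mul, Complex.conj_ofReal, Complex.conj_ofReal, Complex.conj_I]
      ring
    rw [e]
    push_cast
    linear_combination (-(c.im : ℂ) * q) * Complex.I_mul_I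
  have e1 : f (a.polarDh (c • η) ξ)
      = c.re * f (a.polarDh η ξ) - c.im * f (a.polarDh η (Complex.I • ξ)) := by
    rw [polarDh_smul_left, f.map_sub, f.map_smul, f.map_smul, smul_eq_mul, smul_eq_mul]
  have e2 : f (a.polarDh (c • η) (Complex.I • ξ))
      = c.re * f (a.polarDh η (Complex.I • ξ)) + c.im * f (a.polarDh η ξ) := by
    have h : a.polarDh (c • η) (Complex.I • ξ)
        = c.re • a.polarDh η (Complex.I • ξ) + c.im • a.polarDh η ξ := by
      rw [polarDh_smul_left, polarDh_smul_I_smul_I, smul_neg, sub_neg_eq_add]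
    rw [h, f.map_add, f.map_smul, f.map_smul, smul_eq_mul, smul_eq_mul]
  exact (congrArg₂ (fun r s : ℝ => (r : ℂ) - Complex.I * s) e1 e2).trans (alg _ _)

/-- The form on the domain of `a^{1/2}` given by a functional on `𝔇_a^h` that is nonnegative on
`𝔇_a^+`. -/
@[reducible] def formCore (f : a.Dh →L[ℝ] ℝ) (hf : ∀ ψ : a.Dh, (ψ : Functional M) ∈ a.Dpos → 0 ≤ f ψ) :
    PreInnerProductSpace.Core ℂ a.sqrtOp.domain where
  inner := a.complexForm f
  conj_inner_symm := a.conj_complexForm f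
  re_inner_nonneg ξ := by
    change 0 ≤ (a.complexForm f ξ ξ).re
    rw [complexForm_self, Complex.ofReal_re]
    exact hf _ (a.vecFunctional_mem_Dpos ξ)
  add_left := a.complexForm_add_left f
  smul_left η ξ c := a.complexForm_smul_left f c η ξ

/-- $b$ commutes with every $a_l^{1/2}\in M$; in the limit $b$ preserves $D(a^{1/2})$ and commutes
with $a^{1/2}$ there. -/
theorem commutant_smul_mem {b : H →L[ℂ] H} (hb : b ∈ M.commutant) (ξ : a.sqrtOp.domain) :
    Tendsto (fun l => (a.sqrtApprox l : H →L[ℂ] H) (b ξ)) atTop (𝓝 (b (a.sqrtOp ξ))) := by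
  refine ((b.continuous.tendsto _).comp (a.tendsto_sqrtOp ξ)).congr fun l => ?_
  exact (congrArg (fun A : H →L[ℂ] H => A ξ)
    (VonNeumannAlgebra.mem_commutant_iff.1 hb _ (a.sqrtApprox l).2)).symm

variable {a}

/-- A positive functional on `𝔇_a^h` is given on vector functionals by an element of `M`. -/
theorem exists_density (ha : Function.Injective a.op) {f : a.Dh →L[ℝ] ℝ}
    (hf : ∀ ψ : a.Dh, (ψ : Functional M) ∈ a.Dpos → 0 ≤ f ψ) :
    ∃ x : M.toStarSubalgebra, ∀ ξ, a.form x ξ ξ = f (a.vecDh ξ) := by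
  have hinner : ∀ η ξ, (a.formCore f hf).inner η ξ
      = (f (a.polarDh η ξ) : ℂ) - Complex.I * (f (a.polarDh η (Complex.I • ξ)) : ℂ) :=
    fun _ _ => rfl
  have hself : ∀ ξ, (a.formCore f hf).inner ξ ξ = f (a.vecDh ξ) := a.complexForm_self f
  have hd : DenseRange a.sqrtOp.toFun := denseRange_sqrtOp ha
  obtain ⟨T, hT⟩ := exists_clm_of_form (a.formCore f hf) a.sqrtOp.toFun hd (norm_nonneg f)
    (fun ξ => by
      rw [hself, Complex.ofReal_re]
      refine ((le_abs_self _).trans (f.le_opNorm _)).trans ?_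
      exact mul_le_mul_of_nonneg_left (a.norm_vecDh_le ξ) (norm_nonneg _))
  -- By density it suffices to compare matrix entries between vectors $a^{1/2}\eta$ and
  -- $a^{1/2}\xi$, where $b$ can be absorbed into $\xi$ or its adjoint into $\eta$.
  have hTM : T ∈ M := by
    refine mem_of_commute fun b hb => ?_
    have hb' : star b ∈ M.commutant := star_mem hb
    refine ContinuousLinearMap.ext fun v => ?_
    refine congrFun (hd.equalizer (b * T).continuous (T * b).continuous (funext fun ξ => ?_)) v
    refine ext_inner_left ℂ fun w => ?_
    have hc : ∀ k : H, Continuous fun w : H => inner ℂ w k := fun k => by fun_prop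
    refine congrFun (hd.equalizer (hc ((b * T) (a.sqrtOp.toFun ξ)))
      (hc ((T * b) (a.sqrtOp.toFun ξ))) (funext fun η => ?_)) w
    let ξ' : a.sqrtOp.domain := ⟨b ξ, _, a.commutant_smul_mem hb ξ⟩
    let η' : a.sqrtOp.domain := ⟨star b η, _, a.commutant_smul_mem hb' η⟩
    have e1 : a.sqrtOp.toFun ξ' = b (a.sqrtOp.toFun ξ) :=
      a.sqrtOp_eq_of_tendsto (a.commutant_smul_mem hb ξ)
    have e2 : a.sqrtOp.toFun η' = star b (a.sqrtOp.toFun η) :=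
      a.sqrtOp_eq_of_tendsto (a.commutant_smul_mem hb' η)
    change inner ℂ (a.sqrtOp.toFun η) (b (T (a.sqrtOp.toFun ξ)))
      = inner ℂ (a.sqrtOp.toFun η) (T (b (a.sqrtOp.toFun ξ)))
    rw [← e1, hT, ← ContinuousLinearMap.adjoint_inner_left,
      ← ContinuousLinearMap.star_eq_adjoint, ← e2, hT, hinner, hinner]
    -- Elements of $M$ commute with $b$ and $b^*$, so both pairs of vectors define the same
    -- functional on $M$. The cases $c=1$ and $c=i$ give the two parts of the form.
    have key : ∀ c : ℂ, a.polarDh η' (c • ξ) = a.polarDh η (c • ξ') := fun c => by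
      refine Subtype.ext (LinearMap.ext fun y => ?_)
      change polarFunctional M (star b (η : H)) (c • (ξ : H)) y
        = polarFunctional M (η : H) (c • b (ξ : H)) y
      have cb : ∀ v, (y : H →L[ℂ] H) (b v) = b ((y : H →L[ℂ] H) v) := fun v =>
        congrArg (fun A : H →L[ℂ] H => A v) (VonNeumannAlgebra.mem_commutant_iff.1 hb _ y.2)
      have cb' : ∀ v, (y : H →L[ℂ] H) (star b v) = star b ((y : H →L[ℂ] H) v) := fun v =>
        congrArg (fun A : H →L[ℂ] H => A v) (VonNeumannAlgebra.mem_commutant_iff.1 hb' _ y.2)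
      rw [polarFunctional_apply, polarFunctional_apply, cb', map_smul, map_smul, cb,
        inner_smul_right, inner_smul_right, inner_smul_left, inner_smul_left,
        ContinuousLinearMap.star_eq_adjoint, ContinuousLinearMap.adjoint_inner_left,
        ContinuousLinearMap.adjoint_inner_right]
    have k1 := key 1
    rw [one_smul, one_smul] at k1
    rw [k1, key]
  exact ⟨⟨T, hTM⟩, fun ξ => (hT ξ ξ).trans (hself ξ)⟩

/-! ### Approximation by finite sums of vector functionals -/

variable (a) in
theorem tendsto_sum_vecDh {φ : a.Dh} (h : (φ : Functional M) ∈ a.Dpos) :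
    ∃ ξ : ℕ → a.sqrtOp.domain,
      Tendsto (fun N => ∑ n ∈ Finset.range N, a.vecDh (ξ n)) atTop (𝓝 φ) := by
  obtain ⟨ζ, ξ, hζ, hξ, hs⟩ := a.exists_repr_domain h
  refine ⟨ξ, ?_⟩
  have hsum : ∀ N, ((∑ n ∈ Finset.range N, a.vecDh (ξ n) : a.Dh) : Functional M) ∈ a.Dpos := by
    intro N
    induction N with
    | zero => exact a.zero_mem_Dpos
    | succ N ih =>
      rw [Finset.sum_range_succ]
      exact a.add_mem_Dpos ih (a.vecFunctional_mem_Dpos (ξ N))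
  have happ : ∀ N y, ((∑ n ∈ Finset.range N, a.vecDh (ξ n) : a.Dh) : Functional M) y
      = ∑ n ∈ Finset.range N, inner ℂ (ζ n) ((y : H →L[ℂ] H) (ζ n)) := by
    intro N y
    rw [Submodule.coe_sum, LinearMap.sum_apply]
    refine Finset.sum_congr rfl fun n _ => ?_
    rw [← hξ]; rfl
  have hφ : ∀ y : M.toStarSubalgebra, HasSum (fun n => inner ℂ (ζ n) ((y : H →L[ℂ] H) (ζ n)))
      ((φ : Functional M) y) := fun y => by
    rw [hζ y]
    simpa only [diag_apply] using lp.hasSum_inner (𝕜 := ℂ) ζ (diag (y : H →L[ℂ] H) ζ)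
  have heval : ∀ N, a.eval ((φ - ∑ n ∈ Finset.range N, a.vecDh (ξ n) : a.Dh) : Functional M)
      ≤ ENNReal.ofReal (∑' n, ‖a.sqrtOp (ξ (n + N))‖ ^ 2) := fun N => by
    refine iSup₂_le fun l hl => ENNReal.ofReal_le_ofReal ?_
    have h1 := a.hasSum_approx hζ l
    rw [Submodule.coe_sub, LinearMap.sub_apply, happ, Complex.sub_re, Complex.re_sum]
    simp only [← norm_sqrtApprox_sq]
    rw [← h1.tsum_eq, ← h1.summable.sum_add_tsum_nat_add N, add_sub_cancel_left]
    refine ((summable_nat_add_iff N).2 h1.summable).tsum_le_tsum (fun n => ?_)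
      ((summable_nat_add_iff N).2 hs)
    rw [← hξ]
    exact pow_le_pow_left₀ (norm_nonneg _) (a.norm_sqrtApprox_le _ l) 2
  -- The remainder is again in $\mathfrak D_a^+$, so its norm is bounded by its value at $a$, hence
  -- by a tail of $\sum_n\|a^{1/2}\xi_n\|^2$.
  have hmem : ∀ N, ((φ - ∑ n ∈ Finset.range N, a.vecDh (ξ n) : a.Dh) : Functional M)
      ∈ a.Dpos := fun N => by
    refine ⟨fun y hy => ?_, h.2.1.sub (hsum N).2.1, (heval N).trans_lt ENNReal.ofReal_lt_top⟩
    rw [Submodule.coe_sub, LinearMap.sub_apply, happ, sub_nonneg]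
    exact sum_le_hasSum _ (fun n _ => hy.inner_nonneg_right _) (hφ y)
  rw [tendsto_iff_norm_sub_tendsto_zero]
  refine squeeze_zero (fun _ => norm_nonneg _) (fun N => ?_)
    (tendsto_sum_nat_add fun n => ‖a.sqrtOp (ξ n)‖ ^ 2)
  rw [norm_sub_rev]
  refine (a.norm_le_eval (hmem N)).trans ?_
  have h2 := ENNReal.toReal_mono ENNReal.ofReal_ne_top (heval N)
  rwa [ENNReal.toReal_ofReal (tsum_nonneg fun _ => sq_nonneg _)] at h2

variable (a) in
theorem clm_eq_zero_of_vecDh {g : a.Dh →L[ℝ] ℝ} (hg : ∀ ξ, g (a.vecDh ξ) = 0) (φ : a.Dh) :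
    g φ = 0 := by
  have hpos : ∀ ψ : a.Dh, (ψ : Functional M) ∈ a.Dpos → g ψ = 0 := fun ψ hψ => by
    obtain ⟨ξ, hξ⟩ := a.tendsto_sum_vecDh hψ
    refine tendsto_nhds_unique ((g.continuous.tendsto _).comp hξ)
      (tendsto_const_nhds.congr fun N => ?_)
    simp [hg]
  obtain ⟨φ₁, h₁, φ₂, h₂, h⟩ := φ.2
  have e : φ = ⟨φ₁, a.Dpos_subset_Dh h₁⟩ - ⟨φ₂, a.Dpos_subset_Dh h₂⟩ := Subtype.ext h
  rw [e, map_sub, hpos _ h₁, hpos _ h₂, sub_zero]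

/-! ### The closed positive cone and Hahn–Banach separation -/

variable (a) in
/-- The image of `𝔇_a^+` in `L_1^h(a)`. -/
def posCone : Set a.L1h := (fun ψ : a.Dh => (ψ : a.L1h)) '' {ψ | (ψ : Functional M) ∈ a.Dpos}

variable (a) in
theorem convex_posCone : Convex ℝ a.posCone := by
  rintro _ ⟨φ, hφ, rfl⟩ _ ⟨ψ, hψ, rfl⟩ s t hs ht _
  refine ⟨s • φ + t • ψ, a.add_mem_Dpos (a.smul_mem_Dpos hs hφ) (a.smul_mem_Dpos ht hψ), ?_⟩
  simp only [UniformSpace.Completion.coe_add, UniformSpace.Completion.coe_smul]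

/-- The elements of `L_1^h(a)` that are nonnegative on positive forms are limits of elements of
`𝔇_a^+`. -/
theorem mem_closure_posCone (ha : Function.Injective a.op) {χ : a.L1h}
    (hχ : ∀ x : M.toStarSubalgebra, (∀ f, 0 ≤ a.form x f f) → 0 ≤ (a.pairH χ x).re) :
    χ ∈ closure a.posCone := by
  by_contra hc
  obtain ⟨F, u, hu, hF⟩ := geometric_hahn_banach_point_closed a.convex_posCone.closure
    isClosed_closure hc
  let f : a.Dh →L[ℝ] ℝ := F ∘L UniformSpace.Completion.toComplL
  have hu' : ∀ ψ : a.Dh, (ψ : Functional M) ∈ a.Dpos → u < f ψ := fun ψ hψ =>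
    hF _ (subset_closure ⟨ψ, hψ, rfl⟩)
  have hu0 : u < 0 := by simpa using hu' 0 a.zero_mem_Dpos
  have hf : ∀ ψ : a.Dh, (ψ : Functional M) ∈ a.Dpos → 0 ≤ f ψ := fun ψ hψ => by
    by_contra hneg
    push Not at hneg
    -- Both numbers are negative, so the multiple stays in the cone; it is chosen to give $f$
    -- exactly the value $u$, contradicting strict separation.
    have h1 := hu' ((u / f ψ) • ψ) (a.smul_mem_Dpos (div_nonneg_of_nonpos hu0.le hneg.le) hψ)
    rw [map_smul, smul_eq_mul, div_mul_cancel₀ _ hneg.ne] at h1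
    exact h1.false
  obtain ⟨x, hx⟩ := exists_density ha hf
  have h1 : ∀ φ : a.Dh, f φ = (a.sandwich φ x).re := fun φ => by
    have := a.clm_eq_zero_of_vecDh (g := f - Complex.reCLM ∘L a.sandwichCLM x) (fun ξ => by
      change f (a.vecDh ξ) - (a.sandwich (a.vecDh ξ) x).re = 0
      rw [sandwich_vecDh, hx, Complex.ofReal_re, sub_self]) φ
    exact sub_eq_zero.1 this
  have h2 : F χ = (a.pairH χ x).re := by
    refine UniformSpace.Completion.induction_on χ ?_ fun φ => ?_
    · exact isClosed_eq F.continuous (Complex.continuous_re.comp (a.continuous_pairH x))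
    · rw [pairH_coe, ← h1]; rfl
  have h3 := hχ x fun ξ => by
    rw [hx]
    exact Complex.zero_le_real.2 (hf _ (a.vecFunctional_mem_Dpos ξ))
  linarith

/-- Pairings of $L_1^h(a)$ with positive forms are real, so positivity of $\varphi_1+i\varphi_2$
separates into $\varphi_1\ge 0$ and $\varphi_2=0$ on positive forms. -/
theorem mem_L1pos (ha : Function.Injective a.op) {φ : a.L1} (hφ : φ ∈ a.L1pos) :
    φ.2 = 0 ∧ φ.1 ∈ closure a.posCone := by
  have h : ∀ x : M.toStarSubalgebra, (∀ f, 0 ≤ a.form x f f) →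
      0 ≤ (a.pairH φ.1 x).re ∧ (a.pairH φ.2 x).re = 0 := fun x hx => by
    obtain ⟨h1, h2⟩ := Complex.le_def.1 (hφ x hx)
    have i1 := a.im_pairH_eq_zero φ.1 hx
    have i2 := a.im_pairH_eq_zero φ.2 hx
    simp only [pair, Complex.add_re, Complex.add_im, Complex.mul_re, Complex.mul_im,
      Complex.I_re, Complex.I_im, Complex.zero_re, Complex.zero_im, i1, i2] at h1 h2
    constructor <;> linarith
  refine ⟨?_, mem_closure_posCone ha fun x hx => (h x hx).1⟩
  have h1 := mem_closure_posCone ha fun x hx => (h x hx).2.ge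
  have h2 : ∀ f, 0 ≤ a.form (1 : M.toStarSubalgebra) f f := fun f =>
    ContinuousLinearMap.isPositive_one.inner_nonneg_right (a.sqrtOp f)
  -- The inequality of `norm_le_sandwich_one` is a closed condition, so it passes from the cone to
  -- its closure, which contains $\varphi_2$.
  have h3 : closure a.posCone ⊆ {χ | ‖χ‖ ≤ (a.pairH χ 1).re} := by
    refine closure_minimal ?_ (isClosed_le continuous_norm
      (Complex.continuous_re.comp (a.continuous_pairH 1)))
    rintro _ ⟨ψ, hψ, rfl⟩
    change ‖(ψ : a.L1h)‖ ≤ (a.pairH (ψ : a.L1h) 1).re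
    rw [pairH_coe, UniformSpace.Completion.norm_coe]
    exact a.norm_le_sandwich_one hψ
  have h4 : ‖φ.2‖ ≤ (a.pairH φ.2 1).re := h3 h1
  rw [(h 1 h2).2] at h4
  exact norm_le_zero_iff.1 h4

variable (a) in
theorem embed_mem_L1pos {φ : a.Dh} (h : (φ : Functional M) ∈ a.Dpos) : a.embed φ ∈ a.L1pos := by
  intro x hx
  change 0 ≤ a.pairH (φ : a.L1h) x + Complex.I * a.pairH 0 x
  rw [pairH_zero, mul_zero, add_zero, pairH_coe]
  exact a.sandwich_nonneg h hx

theorem exists_normL1_sub_lt (ha : Function.Injective a.op) {φ : a.L1} (hφ : φ ∈ a.L1pos) {ε : ℝ}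
    (hε : 0 < ε) :
    ∃ ψ : a.Dh, (ψ : Functional M) ∈ a.Dpos ∧ a.normL1 (φ - a.embed ψ) < ε := by
  obtain ⟨h1, h2⟩ := mem_L1pos ha hφ
  obtain ⟨_, ⟨ψ, hψ, rfl⟩, h3⟩ := Metric.mem_closure_iff.1 h2 ε hε
  refine ⟨ψ, hψ, ?_⟩
  have e : φ - a.embed ψ = (φ.1 - (ψ : a.L1h), 0) :=
    Prod.ext rfl (by change φ.2 - 0 = 0; rw [h1, sub_zero])
  rw [e]
  rw [dist_eq_norm] at h3
  exact (a.normL1_le _).trans_lt h3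

end PosAffiliatedOp

end AffiliatedL1

end

theorem mainTheorem12 {H : Type*} [NormedAddCommGroup H] [InnerProductSpace ℂ H] [CompleteSpace H]
    (M : VonNeumannAlgebra H) (a : AffiliatedL1.PosAffiliatedOp M)
    (ha : Function.Injective a.op) :
    Function.Injective a.embed ∧
    (∀ φ : a.Dh, (φ : AffiliatedL1.Functional M) ∈ a.Dpos → a.embed φ ∈ a.L1pos) ∧
    (∀ φ ∈ a.L1pos, ∀ ε : ℝ, 0 < ε →
      ∃ ψ : a.Dh, (ψ : AffiliatedL1.Functional M) ∈ a.Dpos ∧ a.normL1 (φ - a.embed ψ) < ε) ∧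
    (∀ φ ∈ a.L1pos, φ.2 = 0 ∧
      φ.1 ∈ closure ((fun ψ : a.Dh => (ψ : a.L1h)) ''
        {ψ | (ψ : AffiliatedL1.Functional M) ∈ a.Dpos})) :=
  ⟨AffiliatedL1.PosAffiliatedOp.embed_injective ha, fun _ h => a.embed_mem_L1pos h,
    fun _ hφ _ hε => AffiliatedL1.PosAffiliatedOp.exists_normL1_sub_lt ha hφ hε,
    fun _ hφ => AffiliatedL1.PosAffiliatedOp.mem_L1pos ha hφ⟩
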